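/- **Definitions.** A *channel* is a Markov kernel. A channel $P$ from $\{+,-\}$ to a measurable space $\mathcal Y$ is a *binary memoryless symmetric (BMS) channel* if there is a measurable involution $\sigma:\mathcal Y\to\mathcal Y$ with $P(E\mid +)=P(\sigma(E)\mid -)$ for all measurable $E\subseteq\mathcal Y$. For a channel $P$ with input alphabet $\{+,-\}$, its $\chi^2$-*capacity* is the $\chi^2$-information $C_{\chi^2}(P)=I_{\chi^2}(X;Y)=D_{\chi^2}(P_{XY}\,\|\,P_X\otimes P_Y)$, where $X$ is uniform on $\{+,-\}$, $Y$ is the output of $P$ on input $X$, and $D_{\chi^2}(\mu\|\nu)=\int(\frac{d\mu}{d\nu}-1)^2\,d\nu$. Let $r\ge 2$ be an integer, $\lambda\in[0,1]$, and let $B_{r,\lambda}:\{+,-\}\to\{+,-\}^{r-1}$ be the channel $$B_{r,\lambda}(x_1,\dots,x_{r-1}\mid y)=\begin{cases}\lambda+2^{-(r-1)}(1-\lambda)&\text{if }x_i=y\text{ for all }i,\\ 2^{-(r-1)}(1-\lambda)&\text{otherwise.}\end{cases}$$ For a probability distribution $D$ on $\mathbb Z_{\ge 0}$ (the offspring distribution)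 put $$\mathrm{BP}(P)=\mathbb E_{t\sim D}\,\bigl(P^{\times(r-1)}\circ B_{r,\lambda}\bigr)^{\star t},$$ where $P^{\times n}$ applies $P$ independently to each of $n$ inputs, $Q^{\star t}$ outputs $t$ independent outputs of $Q$ on one common input, and the expectation is the mixture channel that draws $t\sim D$ independently of the input and outputs $t$ together with the output of the $t$-th channel. Finally let $$s_{r,d,\lambda}(x)=d\lambda^2\cdot\tfrac12\bigl((1+x)^{r-1}-(1-x)^{r-1}\bigr),\qquad g_{r,d,\lambda}(x)=\mathbb E_{Z\sim\mathcal N(0,1)}\tanh\Bigl(s_{r,d,\lambda}(x)+\sqrt{s_{r,d,\lambda}(x)}\,Z\Bigr).$$ **Proposition.** Fix an integer $r\ge 2$. For every $\epsilon>0$ there exists $d_0=d_0(r,\epsilon)>0$ such that for all $d\ge d_0$ and all $\lambda\in[0,1]$ with $(r-1)d\lambda^2\le 1$, and for every BMS channel $P$, $$\bigl|C_{\chi^2}(\mathrm{BP}(P))-g_{r,d,\lambda}(C_{\chi^2}(P))\bigr|\le\epsilon,$$ both when $D$ is the Poisson distribution $\mathrm{Pois}(d)$ ($d$ real) and when $D$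 is the point mass at $d$ ($d$ an integer). -/

import Mathlib

open MeasureTheory ProbabilityTheory
open scoped NNReal ENNReal

namespace BOHT

noncomputable section

/-! The input alphabet `{+, -}` is `Bool`, with `true` for `+` and `false` for `-`.
A channel from `X` to `Y` is a Markov kernel from `X` to `Y`. -/

/-! ### Channels -/

/-- A binary-input channel `P` is a binary memoryless symmetric (BMS) channel if there is a
measurable involution `σ` of the output space with `P(E | +) = P(σ(E) | -)` for all
measurable `E`. -/
def IsBMS {Y : Type*} [MeasurableSpace Y] (P : Kernel Bool Y) : Prop :=
  ∃ σ : Y → Y, Measurable σ ∧ Function.Involutive σ ∧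
    ∀ E : Set Y, MeasurableSet E → P true E = P false (σ '' E)

/-- The tensor power `P^{× n} : X^n → Y^n`: on input `(x_1, …, x_n)` the outputs are independent,
the `i`-th one with law `P(· | x_i)`. (Input alphabets are countable and discrete here, so that
every family of measures is a kernel.) -/
def tensorPow {X Y : Type*} [MeasurableSpace X] [Countable X] [MeasurableSingletonClass X]
    [MeasurableSpace Y] (P : Kernel X Y) (n : ℕ) : Kernel (Fin n → X) (Fin n → Y) :=
  Kernel.ofFunOfCountable fun x => Measure.pi fun i => P (x i)

/-- The `⋆`-power `P^{⋆ n} : X → Y^n`: `n` independent outputs of `P` on one common input. -/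
def starPow {X Y : Type*} [MeasurableSpace X] [Countable X] [MeasurableSingletonClass X]
    [MeasurableSpace Y] (P : Kernel X Y) (n : ℕ) : Kernel X (Fin n → Y) :=
  Kernel.ofFunOfCountable fun x => Measure.pi fun _ => P x

/-- The mixture `𝔼_{t ∼ D} K_t` of a sequence of channels with different output alphabets: `t` is
drawn from `D` independently of the input, and the output is `t` together with the output
of `K_t`. -/
def mixture {X : Type*} {Y : ℕ → Type*} [MeasurableSpace X] [Countable X]
    [MeasurableSingletonClass X] [∀ t, MeasurableSpace (Y t)] (D : Measure ℕ)
    (K : ∀ t, Kernel X (Y t)) : Kernel X (Σ t, Y t) :=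
  Kernel.ofFunOfCountable fun x => Measure.sum fun t => D {t} • (K t x).map (Sigma.mk t)

/-! ### The broadcasting channel and the belief propagation operator -/

/-- The transition probability `B_{r,λ}(x_1, …, x_{r-1} | y)`. -/
def broadcastProb (r : ℕ) (lam : ℝ) (y : Bool) (x : Fin (r - 1) → Bool) : ℝ :=
  if ∀ i, x i = y then lam + 1 / 2 ^ (r - 1) * (1 - lam) else 1 / 2 ^ (r - 1) * (1 - lam)

/-- The broadcasting channel `B_{r,λ} : {±} → {±}^{r-1}`. -/
def broadcast (r : ℕ) (lam : ℝ) : Kernel Bool (Fin (r - 1) → Bool) :=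
  Kernel.ofFunOfCountable fun y =>
    ∑ x : Fin (r - 1) → Bool, ENNReal.ofReal (broadcastProb r lam y x) • Measure.dirac x

/-- The belief propagation operator
`BP(P) = 𝔼_{t ∼ D} (P^{× (r-1)} ∘ B_{r,λ})^{⋆ t}` with offspring distribution `D`. -/
def bp (r : ℕ) (lam : ℝ) (D : Measure ℕ) {Y : Type*} [MeasurableSpace Y] (P : Kernel Bool Y) :
    Kernel Bool (Σ t : ℕ, Fin t → Fin (r - 1) → Y) :=
  mixture D fun t => starPow (tensorPow P (r - 1) ∘ₖ broadcast r lam) t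

/-! ### The `χ²`-capacity -/

open Classical in
/-- The `χ²`-divergence `D_{χ²}(μ ‖ ν) = ∫ (dμ/dν - 1)² dν`, infinite unless `μ ≪ ν`. -/
def chiSqDiv {Z : Type*} [MeasurableSpace Z] (μ ν : Measure Z) : ℝ≥0∞ :=
  if μ ≪ ν then ∫⁻ z, ENNReal.ofReal (((μ.rnDeriv ν z).toReal - 1) ^ 2) ∂ν else ∞

/-- The `χ²`-information `I_{χ²}(π, P) = D_{χ²}(P_{XY} ‖ P_X ⊗ P_Y)`, where `X ∼ π` and `Y` is the
output of `P` on input `X`. -/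
def chiSqInfo {X Y : Type*} [MeasurableSpace X] [MeasurableSpace Y] (π : Measure X)
    (P : Kernel X Y) : ℝ≥0∞ :=
  chiSqDiv (π ⊗ₘ P) (π.prod (P ∘ₘ π))

/-- The `χ²`-capacity `C_{χ²}(P) = I_{χ²}(Unif({±}), P)`. The information is finite for every
binary-input channel, see `chiSqInfo_uniform_le_one` below. -/
def chiSqCap {Y : Type*} [MeasurableSpace Y] (P : Kernel Bool Y) : ℝ :=
  (chiSqInfo (PMF.uniformOfFintype Bool).toMeasure P).toReal

/-! ### The limiting recursion -/

/-- `s_{r,d,λ}(x) = d λ² · ½ ((1+x)^{r-1} - (1-x)^{r-1})`. -/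
def s (r : ℕ) (d lam x : ℝ) : ℝ :=
  d * lam ^ 2 * (1 / 2) * ((1 + x) ^ (r - 1) - (1 - x) ^ (r - 1))

/-- `g_{r,d,λ}(x) = 𝔼_{Z ∼ N(0,1)} tanh (s_{r,d,λ}(x) + √(s_{r,d,λ}(x)) Z)`. -/
def g (r : ℕ) (d lam x : ℝ) : ℝ :=
  ∫ z, Real.tanh (s r d lam x + √(s r d lam x) * z) ∂(gaussianReal 0 1)

/-! ### The objects above are channels, and the `χ²`-capacity is well defined -/

instance {X Y : Type*} [MeasurableSpace X] [Countable X] [MeasurableSingletonClass X]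
    [MeasurableSpace Y] (P : Kernel X Y) [IsMarkovKernel P] (n : ℕ) :
    IsMarkovKernel (tensorPow P n) :=
  ⟨fun x => inferInstanceAs (IsProbabilityMeasure (Measure.pi fun i => P (x i)))⟩

instance {X Y : Type*} [MeasurableSpace X] [Countable X] [MeasurableSingletonClass X]
    [MeasurableSpace Y] (P : Kernel X Y) [IsMarkovKernel P] (n : ℕ) :
    IsMarkovKernel (starPow P n) :=
  ⟨fun x => inferInstanceAs (IsProbabilityMeasure (Measure.pi fun _ => P x))⟩

instance {X : Type*} {Y : ℕ → Type*} [MeasurableSpace X] [Countable X]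
    [MeasurableSingletonClass X] [∀ t, MeasurableSpace (Y t)] (D : Measure ℕ)
    [IsProbabilityMeasure D] (K : ∀ t, Kernel X (Y t)) [∀ t, IsMarkovKernel (K t)] :
    IsMarkovKernel (mixture D K) := by
  refine ⟨fun x => ⟨?_⟩⟩
  change (Measure.sum fun t => D {t} • (K t x).map (Sigma.mk t)) Set.univ = 1
  rw [Measure.sum_apply _ MeasurableSet.univ]
  have hm : ∀ t, Measurable (Sigma.mk t : Y t → Σ t, Y t) := fun t => by
    intro u hu
    exact (MeasurableSpace.measurableSet_iInf.1 hu) t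
  have h : ∀ t, (D {t} • (K t x).map (Sigma.mk t)) Set.univ = D {t} := fun t => by
    rw [Measure.smul_apply, Measure.map_apply (hm t) MeasurableSet.univ]
    simp
  simp_rw [h]
  have := Measure.tsum_indicator_apply_singleton D Set.univ MeasurableSet.univ
  simpa using this

theorem isMarkovKernel_broadcast (r : ℕ) {lam : ℝ} (hlam : lam ∈ Set.Icc (0 : ℝ) 1) :
    IsMarkovKernel (broadcast r lam) := by
  obtain ⟨h0, h1⟩ := hlam
  refine ⟨fun y => ⟨?_⟩⟩
  change (∑ x : Fin (r - 1) → Bool,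
    ENNReal.ofReal (broadcastProb r lam y x) • Measure.dirac x : Measure _) Set.univ = 1
  have hn : ∀ x, 0 ≤ broadcastProb r lam y x := fun x => by
    have : 0 ≤ 1 - lam := by linarith
    unfold broadcastProb
    split_ifs <;> positivity
  have hsum : ∑ x : Fin (r - 1) → Bool, broadcastProb r lam y x = 1 := by
    have : ∀ x : Fin (r - 1) → Bool, broadcastProb r lam y x
        = (if x = (fun _ => y) then lam else 0) + 1 / 2 ^ (r - 1) * (1 - lam) := fun x => by
      unfold broadcastProb
      simp only [funext_iff]
      split_ifs <;> ring
    simp only [this, Finset.sum_add_distrib, Finset.sum_ite_eq', Finset.mem_univ, if_true,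
      Finset.sum_const, Finset.card_univ, Fintype.card_fun, Fintype.card_bool, Fintype.card_fin,
      nsmul_eq_mul]
    push_cast
    field_simp
    ring
  simp only [Measure.coe_finsetSum, Finset.sum_apply, Measure.smul_apply, measure_univ,
    smul_eq_mul, mul_one]
  rw [← ENNReal.ofReal_sum_of_nonneg fun x _ => hn x, hsum, ENNReal.ofReal_one]

theorem isMarkovKernel_bp (r : ℕ) {lam : ℝ} (hlam : lam ∈ Set.Icc (0 : ℝ) 1) (D : Measure ℕ)
    [IsProbabilityMeasure D] {Y : Type*} [MeasurableSpace Y] (P : Kernel Bool Y)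
    [IsMarkovKernel P] : IsMarkovKernel (bp r lam D P) := by
  have := isMarkovKernel_broadcast r hlam
  unfold bp
  infer_instance

theorem chiSqInfo_uniform_le_one {Y : Type*} [MeasurableSpace Y] (P : Kernel Bool Y)
    [IsMarkovKernel P] : chiSqInfo (PMF.uniformOfFintype Bool).toMeasure P ≤ 1 := by
  set π := (PMF.uniformOfFintype Bool).toMeasure with hπ
  have hs : ∀ b : Bool, π {b} = 2⁻¹ := fun b => by
    rw [hπ, PMF.toMeasure_apply_singleton _ _ (measurableSet_singleton b)]
    simp
  have hP : ∀ b, P b ≤ (2 : ℝ≥0) • (P ∘ₘ π) := fun b => by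
    refine Measure.le_iff.2 fun E hE => ?_
    rw [Measure.smul_apply, Measure.bind_apply hE P.aemeasurable, lintegral_fintype]
    simp only [Fintype.sum_bool, hs]
    rw [← add_mul, ENNReal.smul_def, smul_eq_mul, mul_comm, mul_assoc, ENNReal.coe_ofNat,
      ENNReal.inv_mul_cancel (by norm_num) (by norm_num), mul_one]
    cases b
    · exact le_add_self
    · exact le_self_add
  have hle : π ⊗ₘ P ≤ (2 : ℝ≥0) • π.prod (P ∘ₘ π) := by
    refine Measure.le_iff.2 fun E hE => ?_
    rw [Measure.smul_apply, Measure.compProd_apply hE, Measure.prod_apply hE,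
      ENNReal.smul_def, smul_eq_mul, ← lintegral_const_mul _ (measurable_of_countable _)]
    exact lintegral_mono fun b => hP b _
  have hac : π ⊗ₘ P ≪ π.prod (P ∘ₘ π) :=
    (Measure.absolutelyContinuous_of_le hle).trans (Measure.smul_absolutelyContinuous)
  have hr : (π ⊗ₘ P).rnDeriv (π.prod (P ∘ₘ π)) ≤ᵐ[π.prod (P ∘ₘ π)] fun _ => 2 := by
    have hac2 : π.prod (P ∘ₘ π) ≪ (2 : ℝ≥0) • π.prod (P ∘ₘ π) :=
      Measure.absolutelyContinuous_smul two_ne_zero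
    filter_upwards [hac2.ae_le (Measure.rnDeriv_le_one_of_le hle),
      Measure.rnDeriv_smul_right (π ⊗ₘ P) (π.prod (P ∘ₘ π)) (two_ne_zero : (2 : ℝ≥0) ≠ 0)]
      with z hz hz2
    rw [hz2] at hz
    simp only [Pi.smul_apply, Pi.one_apply, ENNReal.smul_def, smul_eq_mul] at hz
    rw [ENNReal.coe_inv two_ne_zero, ENNReal.coe_ofNat] at hz
    calc (π ⊗ₘ P).rnDeriv (π.prod (P ∘ₘ π)) z
        = 2 * (2⁻¹ * (π ⊗ₘ P).rnDeriv (π.prod (P ∘ₘ π)) z) := by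
          rw [← mul_assoc, ENNReal.mul_inv_cancel (by norm_num) (by norm_num), one_mul]
      _ ≤ 2 * 1 := by gcongr
      _ = 2 := mul_one 2
  unfold chiSqInfo chiSqDiv
  rw [if_pos hac]
  calc _ ≤ ∫⁻ _, 1 ∂(π.prod (P ∘ₘ π)) := by
        refine lintegral_mono_ae ?_
        filter_upwards [hr] with z hz
        have h2 : ((π ⊗ₘ P).rnDeriv (π.prod (P ∘ₘ π)) z).toReal ≤ 2 :=
          ENNReal.toReal_le_of_le_ofReal (by norm_num) (by simpa using hz)
        have h0 : 0 ≤ ((π ⊗ₘ P).rnDeriv (π.prod (P ∘ₘ π)) z).toReal := ENNReal.toReal_nonneg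
        exact ENNReal.ofReal_le_one.2 (by nlinarith)
    _ = 1 := by simp

end

end BOHT

namespace BOHT

/-! Condition on the input `+` and let `L` be half the log-likelihood ratio of the output of
`BP(P)`. The `χ²`-capacity is the mean of `tanh L` (`chiSqCap_eq_integral_tanh`), so it suffices to
show that `L` is nearly `N(s, s)`, with a uniform error.

Given `t` children, `L` is a sum of `t` i.i.d. terms, one per child hyperedge. One hyperedge has
likelihood `1 + λ (∏ (1 ± η) - 1)`, where `1 ± η` are the densities of `P` relative to its average
output law. So each term is `O(λ)`, and `λ ≤ d^(-1/2)` puts the sum in the central limit regime. A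
second-order expansion (`norm_exp_logRatio_sub_le`, `IsTilt.norm_charFun_child_sub_le`) gives one
term the characteristic function `1 + (iξ - ξ²/2) s/d + O(λ³)`. The same coefficient `s/d` serves as
mean and variance because the law is tilted by the likelihood itself, and it depends on `P` only
through its capacity (`IsTilt.integral_childDensity_sub_sq`).

The characteristic function of `L` is the generating function of the offspring law at this point.
For both offspring laws it is `exp ((iξ - ξ²/2) s)` up to `O(d λ³) = O(d^(-1/2))`, with constants
depending only on `r` and `ξ` (`IsTilt.norm_charFun_llrLaw_sub_le`). Lévy's continuity theorem and
compactness of the range of `s` turn this into a bound uniform in `P` and `λ`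
(`exists_abs_integral_tanh_sub_le`). -/

/-! ### From characteristic functions to the mean of `tanh`, by compactness -/

open Filter Topology Complex in
theorem charFun_gaussianReal_self (s : ℝ) (hs : 0 ≤ s) (ξ : ℝ) :
    charFun (gaussianReal s s.toNNReal) ξ = cexp ((I * ξ - ξ ^ 2 / 2) * s) := by
  rw [charFun_gaussianReal, Real.coe_toNNReal s hs]
  congr 1
  ring

theorem continuous_tanh : Continuous Real.tanh := by
  have : Real.tanh = fun x => Real.sinh x / Real.cosh x := by
    ext x; exact Real.tanh_eq_sinh_div_cosh x
  rw [this]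
  exact Real.continuous_sinh.div Real.continuous_cosh fun x => (Real.cosh_pos x).ne'

/-- `tanh` as a bounded continuous function. -/
noncomputable def tanhBCF : BoundedContinuousFunction ℝ ℝ :=
  BoundedContinuousFunction.ofNormedAddCommGroup Real.tanh continuous_tanh 1 fun x => by
    rw [Real.norm_eq_abs]
    exact (Real.abs_tanh_lt_one x).le

open Filter Topology Complex in
/-- A quantitative assumption on the characteristic function forces `∫ tanh` to be close to its
value at the Gaussian law `N(s, s)`, uniformly in `s ∈ [0, S]` and in the measure. -/
theorem exists_abs_integral_tanh_sub_le (S : ℝ) (C : ℝ → ℝ) {ε : ℝ} (hε : 0 < ε) :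
    ∃ d₀ : ℝ, 0 < d₀ ∧ ∀ d : ℝ, d₀ ≤ d → ∀ s ∈ Set.Icc (0 : ℝ) S, ∀ ν : Measure ℝ,
      IsProbabilityMeasure ν →
      (∀ ξ : ℝ, ‖charFun ν ξ - cexp ((I * ξ - ξ ^ 2 / 2) * s)‖ ≤ C ξ / √d) →
      |∫ x, Real.tanh x ∂ν - ∫ x, Real.tanh x ∂(gaussianReal s s.toNNReal)| ≤ ε := by
  -- Lévy's theorem gives no rate, so uniformity comes from compactness: a sequence of
  -- counterexamples with `d → ∞` has a subsequence with `s → s₀`. Along it both `ν` and `N(s, s)`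
  -- converge weakly to `N(s₀, s₀)`, so their means of `tanh` merge.
  by_contra! hcon
  have h := fun k : ℕ => hcon ((k : ℝ) + 1) (by positivity)
  choose d hd s hs ν hν hφ hgt using h
  obtain ⟨s₀, hs₀, σ, hσ, hlim⟩ := isCompact_Icc.tendsto_subseq hs
  have hdlim : Tendsto d atTop atTop :=
    tendsto_atTop_mono (fun k => (by linarith [hd k] : (k : ℝ) ≤ d k)) tendsto_natCast_atTop_atTop
  let G : ℝ → ProbabilityMeasure ℝ := fun s => ⟨gaussianReal s s.toNNReal, inferInstance⟩
  have hexp : ∀ ξ : ℝ, Tendsto (fun k => cexp ((I * ξ - ξ ^ 2 / 2) * (s (σ k) : ℝ))) atTop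
      (𝓝 (charFun (G s₀ : Measure ℝ) ξ)) := fun ξ => by
    change Tendsto _ _ (𝓝 (charFun (gaussianReal s₀ s₀.toNNReal) ξ))
    rw [charFun_gaussianReal_self _ hs₀.1]
    exact (Complex.continuous_exp.tendsto _).comp
      (tendsto_const_nhds.mul ((Complex.continuous_ofReal.tendsto _).comp hlim))
  have h1 : Tendsto (fun k => G (s (σ k))) atTop (𝓝 (G s₀)) := by
    refine ProbabilityMeasure.tendsto_iff_tendsto_charFun.2 fun ξ => ?_
    refine (hexp ξ).congr fun k => ?_
    exact (charFun_gaussianReal_self _ (hs _).1 ξ).symm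
  let V : ℕ → ProbabilityMeasure ℝ := fun k => ⟨ν (σ k), hν _⟩
  have h2 : Tendsto V atTop (𝓝 (G s₀)) := by
    refine ProbabilityMeasure.tendsto_iff_tendsto_charFun.2 fun ξ => ?_
    have hz : Tendsto (fun k => charFun (ν (σ k)) ξ
        - cexp ((I * ξ - ξ ^ 2 / 2) * (s (σ k) : ℝ))) atTop (𝓝 0) := by
      refine squeeze_zero_norm (fun k => hφ (σ k) ξ) ?_
      exact tendsto_const_nhds.div_atTop
        (Real.tendsto_sqrt_atTop.comp (hdlim.comp hσ.tendsto_atTop))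
    simpa [V] using hz.add (hexp ξ)
  have h3 := (ProbabilityMeasure.tendsto_iff_forall_integral_tendsto.1 h1 tanhBCF)
  have h4 := (ProbabilityMeasure.tendsto_iff_forall_integral_tendsto.1 h2 tanhBCF)
  have h5 := (h4.sub h3).abs
  rw [sub_self, abs_zero] at h5
  obtain ⟨k, hk⟩ := (h5.eventually (gt_mem_nhds hε)).exists
  exact absurd hk (hgt (σ k)).not_gt

theorem g_eq_integral_gaussianReal (r : ℕ) (d lam x : ℝ) (hs : 0 ≤ s r d lam x) :
    g r d lam x =
      ∫ y, Real.tanh y ∂(gaussianReal (s r d lam x) (s r d lam x).toNNReal) := by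
  set u := s r d lam x with hu
  have h : gaussianReal u u.toNNReal = (gaussianReal 0 1).map (fun z => u + √u * z) := by
    have h1 := gaussianReal_map_const_mul (μ := 0) (v := 1) (√u)
    have h2 : (fun z => u + √u * z) = (fun z => u + z) ∘ fun z => √u * z := rfl
    rw [h2, ← Measure.map_map (by fun_prop) (by fun_prop), h1, gaussianReal_map_const_add]
    congr 1
    · simp
    · ext
      simp [Real.sq_sqrt hs, hs]
  rw [h, integral_map (by fun_prop) continuous_tanh.aestronglyMeasurable, g]

/-! ### Elementary estimates for `exp` and `log` -/

open Complex

/-- The left half-plane is convex and the derivative of `exp` has norm at most 1 there. -/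
theorem norm_exp_sub_exp_le {u v : ℂ} (hu : u.re ≤ 0) (hv : v.re ≤ 0) :
    ‖cexp u - cexp v‖ ≤ ‖u - v‖ := by
  have := (convex_halfSpace_re_le (0 : ℝ)).norm_image_sub_le_of_norm_hasDerivWithin_le
    (f := cexp) (f' := cexp) (C := 1) (x := v) (y := u)
    (fun x _ => (Complex.hasDerivAt_exp x).hasDerivWithinAt)
    (fun x hx => by
      rw [Complex.norm_exp]
      exact Real.exp_le_one_iff.2 hx) hv hu
  simpa using this

theorem norm_exp_sub_one_sub_le {z : ℂ} (hz : z.re ≤ 0) : ‖cexp z - 1 - z‖ ≤ 3 * ‖z‖ ^ 2 := by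
  rcases le_total ‖z‖ 1 with h | h
  · refine (Complex.norm_exp_sub_one_sub_id_le h).trans ?_
    nlinarith [sq_nonneg ‖z‖]
  · have h1 : ‖cexp z‖ ≤ 1 := by
      rw [Complex.norm_exp]
      exact Real.exp_le_one_iff.2 hz
    calc ‖cexp z - 1 - z‖ ≤ ‖cexp z‖ + ‖(1 : ℂ)‖ + ‖z‖ :=
          (norm_sub_le _ _).trans (add_le_add_left (norm_sub_le _ _) _)
      _ ≤ 1 + 1 + ‖z‖ := by
          rw [norm_one]
          gcongr
      _ ≤ 3 * ‖z‖ ^ 2 := by nlinarith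

theorem norm_exp_I_mul_sub_taylor_le (y : ℝ) :
    ‖cexp (I * y) - (1 + I * y - (y ^ 2 / 2 : ℝ))‖ ≤ 4 * |y| ^ 3 := by
  have hn : ‖I * (y : ℂ)‖ = |y| := by simp
  rcases le_total |y| 1 with h | h
  · have h1 := Complex.exp_bound (x := I * y) (by rwa [hn]) (n := 3) (by norm_num)
    rw [hn] at h1
    have h2 : (∑ m ∈ Finset.range 3, (I * (y : ℂ)) ^ m / (m.factorial : ℂ))
        = 1 + I * y - (y ^ 2 / 2 : ℝ) := by
      simp only [Finset.sum_range_succ, Finset.sum_range_zero, Nat.factorial]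
      push_cast
      rw [show (I * (y : ℂ)) ^ 2 = -(y : ℂ) ^ 2 by rw [mul_pow, I_sq]; ring]
      ring
    rw [h2] at h1
    refine h1.trans ?_
    have : 0 ≤ |y| ^ 3 := by positivity
    norm_num [Nat.factorial]
    linarith
  · have h1 : ‖cexp (I * y)‖ = 1 := by rw [mul_comm]; exact Complex.norm_exp_ofReal_mul_I y
    have h3 : ‖((y ^ 2 / 2 : ℝ) : ℂ)‖ = |y| ^ 2 / 2 := by
      rw [Complex.norm_real, Real.norm_eq_abs, abs_div, abs_pow]; norm_num
    calc ‖cexp (I * y) - (1 + I * y - (y ^ 2 / 2 : ℝ))‖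
        ≤ ‖cexp (I * y)‖ + (‖(1 : ℂ)‖ + ‖I * (y : ℂ)‖ + ‖((y ^ 2 / 2 : ℝ) : ℂ)‖) := by
          refine (norm_sub_le _ _).trans ?_
          gcongr
          refine (norm_sub_le _ _).trans ?_
          gcongr
          exact norm_add_le _ _
      _ = 1 + (1 + |y| + |y| ^ 2 / 2) := by rw [h1, h3, hn, norm_one]
      _ ≤ 4 * |y| ^ 3 := by
          have h4 : |y| ≤ |y| ^ 3 := le_self_pow₀ h (by norm_num)
          have h5 : |y| ^ 2 ≤ |y| ^ 3 := pow_le_pow_right₀ h (by norm_num)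
          linarith

theorem abs_log_one_add_sub_le {a : ℝ} (ha : |a| ≤ 1 / 2) :
    |Real.log (1 + a) - (a - a ^ 2 / 2)| ≤ 2 * |a| ^ 3 := by
  have h := Real.abs_log_sub_add_sum_range_le (x := -a) (by rw [abs_neg]; linarith) 2
  simp only [Finset.sum_range_succ, Finset.sum_range_zero, abs_neg, sub_neg_eq_add] at h
  have h2 : |a| ^ (2 + 1) / (1 - |a|) ≤ 2 * |a| ^ 3 := by
    rw [div_le_iff₀ (by linarith)]
    have : 0 ≤ |a| ^ 3 := by positivity
    norm_num
    nlinarith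
  refine le_trans (le_of_eq ?_) (h.trans h2)
  congr 1
  push_cast
  ring

/-- The constant in `norm_exp_logRatio_sub_le`. -/
noncomputable def taylorConst (ξ : ℝ) : ℝ := 48 * |ξ| ^ 3 + 5 * ξ ^ 2 + 4 * |ξ|

theorem taylorConst_nonneg (ξ : ℝ) : 0 ≤ taylorConst ξ := by
  unfold taylorConst; positivity

/-- Second-order expansion of the tilted exponential of a half log-likelihood ratio. -/
theorem norm_exp_logRatio_sub_le {a b δ : ℝ} (ξ : ℝ) (ha : |a| ≤ δ) (hb : |b| ≤ δ)
    (hδ : δ ≤ 1 / 2) :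
    ‖((1 + a : ℝ) : ℂ) * cexp (I * (ξ * ((Real.log (1 + a) - Real.log (1 + b)) / 2) : ℝ))
      - ((1 + a : ℝ) + I * ξ * ((a - b) / 2 : ℝ)
          + (I * ξ - ξ ^ 2 / 2) * ((a - b) ^ 2 / 4 : ℝ))‖ ≤ taylorConst ξ * δ ^ 3 := by
  have hδ0 : 0 ≤ δ := (abs_nonneg a).trans ha
  set l := (Real.log (1 + a) - Real.log (1 + b)) / 2 with hl
  set h := (a - b) / 2 with hh
  have ha3 : |a| ^ 3 ≤ δ ^ 3 := pow_le_pow_left₀ (abs_nonneg a) ha 3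
  have hb3 : |b| ^ 3 ≤ δ ^ 3 := pow_le_pow_left₀ (abs_nonneg b) hb 3
  obtain ⟨e, he, hle⟩ : ∃ e, |e| ≤ 2 * δ ^ 3 ∧ l = h - (a ^ 2 - b ^ 2) / 4 + e := by
    refine ⟨l - (h - (a ^ 2 - b ^ 2) / 4), ?_, by ring⟩
    have h1 := abs_le.1 (abs_log_one_add_sub_le (ha.trans hδ))
    have h2 := abs_le.1 (abs_log_one_add_sub_le (hb.trans hδ))
    rw [abs_le, hl, hh]
    constructor <;> linarith [h1.1, h1.2, h2.1, h2.2]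
  have hδ2 : δ ^ 2 ≤ δ / 2 := by nlinarith
  have hδ3 : δ ^ 3 ≤ δ ^ 2 / 2 := by nlinarith [sq_nonneg δ]
  obtain ⟨ha1, ha2⟩ := abs_le.1 ha
  obtain ⟨hb1, hb2⟩ := abs_le.1 hb
  have hasq : a ^ 2 ≤ δ ^ 2 := sq_le_sq' ha1 ha2
  have hbsq : b ^ 2 ≤ δ ^ 2 := sq_le_sq' hb1 hb2
  have hq : |(a ^ 2 - b ^ 2) / 4| ≤ δ ^ 2 / 4 := by
    rw [abs_le]; constructor <;> nlinarith [sq_nonneg a, sq_nonneg b]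
  have hhd : |h| ≤ δ := by rw [abs_le, hh]; constructor <;> linarith
  have hlh : |l - h| ≤ 5 / 4 * δ ^ 2 := by
    obtain ⟨q1, q2⟩ := abs_le.1 hq
    obtain ⟨e1, e2⟩ := abs_le.1 he
    rw [abs_le, hle]; constructor <;> linarith
  have hld : |l| ≤ 2 * δ := by
    obtain ⟨q1, q2⟩ := abs_le.1 hlh
    obtain ⟨e1, e2⟩ := abs_le.1 hhd
    rw [abs_le]; constructor <;> linarith
  -- The exact identity `h * a - (a ^ 2 - b ^ 2) / 4 = h ^ 2` shows that the tilt by `1 + a` shifts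
  -- the first moment by `h ^ 2`. This is also the leading second moment in `hB2`, which is why mean
  -- and variance agree in the limit.
  have hB1 : |l * (1 + a) - h - h ^ 2| ≤ 4 * δ ^ 3 := by
    have heq : l * (1 + a) - h - h ^ 2 = e * (1 + a) - a * ((a ^ 2 - b ^ 2) / 4) := by
      rw [hle, hh]; ring
    rw [heq]
    calc _ ≤ |e| * |1 + a| + |a| * |(a ^ 2 - b ^ 2) / 4| := by
          rw [← abs_mul, ← abs_mul]; exact abs_sub _ _
      _ ≤ (2 * δ ^ 3) * (3 / 2) + δ * (δ ^ 2 / 4) := by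
          gcongr
          rw [abs_le]; constructor <;> linarith
      _ ≤ 4 * δ ^ 3 := by nlinarith [pow_nonneg hδ0 3]
  have hB2 : |l ^ 2 * (1 + a) - h ^ 2| ≤ 10 * δ ^ 3 := by
    have heq : l ^ 2 * (1 + a) - h ^ 2 = l ^ 2 * a + (l - h) * (l + h) := by ring
    rw [heq]
    calc _ ≤ |l| ^ 2 * |a| + |l - h| * |l + h| := by
          rw [← abs_mul, ← abs_pow, ← abs_mul]; exact abs_add_le _ _
      _ ≤ (2 * δ) ^ 2 * δ + (5 / 4 * δ ^ 2) * (2 * δ + δ) := by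
          gcongr
          exact (abs_add_le _ _).trans (add_le_add hld hhd)
      _ ≤ 10 * δ ^ 3 := by nlinarith [pow_nonneg hδ0 3]
  have hexp := norm_exp_I_mul_sub_taylor_le (ξ * l)
  set E := cexp (I * (ξ * l : ℝ)) with hE
  have key : ((1 + a : ℝ) : ℂ) * E - ((1 + a : ℝ) + I * ξ * (h : ℝ)
          + (I * ξ - ξ ^ 2 / 2) * ((a - b) ^ 2 / 4 : ℝ))
      = ((1 + a : ℝ) : ℂ) * (E - (1 + I * (ξ * l : ℝ) - ((ξ * l) ^ 2 / 2 : ℝ)))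
        + (I * ξ * ((l * (1 + a) - h - h ^ 2 : ℝ) : ℂ)
        - ((ξ ^ 2 / 2 : ℝ) : ℂ) * ((l ^ 2 * (1 + a) - h ^ 2 : ℝ) : ℂ)) := by
    rw [hh]
    push_cast
    ring
  rw [key]
  have h1a : |1 + a| ≤ 3 / 2 := by rw [abs_le]; constructor <;> linarith
  calc _ ≤ |1 + a| * (4 * |ξ * l| ^ 3) + (|ξ| * |l * (1 + a) - h - h ^ 2|
          + |ξ ^ 2 / 2| * |l ^ 2 * (1 + a) - h ^ 2|) := by
        refine (norm_add_le _ _).trans (add_le_add ?_ ((norm_sub_le _ _).trans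
          (add_le_add ?_ ?_)))
        · rw [norm_mul, Complex.norm_real, Real.norm_eq_abs]
          gcongr
        · rw [norm_mul, norm_mul, Complex.norm_real, Complex.norm_real, Complex.norm_I, one_mul,
            Real.norm_eq_abs, Real.norm_eq_abs]
        · rw [norm_mul, Complex.norm_real, Complex.norm_real, Real.norm_eq_abs, Real.norm_eq_abs]
    _ ≤ 3 / 2 * (4 * (|ξ| * (2 * δ)) ^ 3) + (|ξ| * (4 * δ ^ 3) + ξ ^ 2 / 2 * (10 * δ ^ 3)) := by
        rw [abs_mul, abs_of_nonneg (by positivity : 0 ≤ ξ ^ 2 / 2)]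
        gcongr
    _ = taylorConst ξ * δ ^ 3 := by
        unfold taylorConst; ring

theorem norm_pow_sub_pow_le_mul {u v : ℂ} (hu : ‖u‖ ≤ 1) (hv : ‖v‖ ≤ 1) (n : ℕ) :
    ‖u ^ n - v ^ n‖ ≤ n * ‖u - v‖ := by
  induction n with
  | zero => simp
  | succ n ih =>
    have : u ^ (n + 1) - v ^ (n + 1) = u ^ n * (u - v) + (u ^ n - v ^ n) * v := by ring
    rw [this]
    calc _ ≤ ‖u‖ ^ n * ‖u - v‖ + ‖u ^ n - v ^ n‖ * ‖v‖ := by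
          rw [← norm_pow, ← norm_mul, ← norm_mul]; exact norm_add_le _ _
      _ ≤ 1 * ‖u - v‖ + (n * ‖u - v‖) * 1 := by
          gcongr
          exact pow_le_one₀ (norm_nonneg _) hu
      _ = _ := by push_cast; ring

/-! ### Binary-input channels as tilts of the average output law -/

theorem integral_withDensity_ofReal {Z E : Type*} [MeasurableSpace Z] [NormedAddCommGroup E]
    [NormedSpace ℝ E] (μ : Measure Z) {f : Z → ℝ} (hf : Measurable f) (hf0 : ∀ z, 0 ≤ f z)
    (u : Z → E) :
    ∫ z, u z ∂(μ.withDensity fun z => ENNReal.ofReal (f z)) = ∫ z, f z • u z ∂μ := by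
  rw [integral_withDensity_eq_integral_toReal_smul hf.ennreal_ofReal
    (Filter.Eventually.of_forall fun _ => ENNReal.ofReal_lt_top)]
  simp only [ENNReal.toReal_ofReal (hf0 _)]

/-- The sign `±1` of an input symbol. -/
def sgn : Bool → ℝ
  | true => 1
  | false => -1

theorem one_add_sgn_mul_nonneg {x : ℝ} (hx : |x| ≤ 1) (b : Bool) : 0 ≤ 1 + sgn b * x := by
  obtain ⟨h1, h2⟩ := abs_le.1 hx
  cases b <;> simp only [sgn] <;> linarith

/-- `P(· | b)` has density `1 ± η` with respect to `N`, where `|η| ≤ 1`. -/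
structure IsTilt {Y : Type*} [MeasurableSpace Y] (P : Kernel Bool Y) (N : Measure Y)
    (η : Y → ℝ) : Prop where
  measurable : Measurable η
  abs_le_one : ∀ y, |η y| ≤ 1
  eq_withDensity : ∀ b, P b = N.withDensity fun y => ENNReal.ofReal (1 + sgn b * η y)

theorem IsTilt.measurable_density {Y : Type*} [MeasurableSpace Y] {P : Kernel Bool Y}
    {N : Measure Y} {η : Y → ℝ} (h : IsTilt P N η) (b : Bool) :
    Measurable fun y => 1 + sgn b * η y :=
  measurable_const.add (h.measurable.const_mul _)

theorem withDensity_one_add_sub {Y : Type*} [MeasurableSpace Y] (N : Measure Y) {η : Y → ℝ}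
    (hη : Measurable η) (h1 : ∀ y, |η y| ≤ 1) :
    (N.withDensity fun y => ENNReal.ofReal (1 + sgn true * η y))
      + (N.withDensity fun y => ENNReal.ofReal (1 + sgn false * η y)) = (2 : ℝ≥0∞) • N := by
  rw [← withDensity_add_left (by fun_prop), ← withDensity_const]
  congr 1
  ext y
  rw [Pi.add_apply, ← ENNReal.ofReal_add (one_add_sgn_mul_nonneg (h1 y) _)
    (one_add_sgn_mul_nonneg (h1 y) _)]
  simp only [sgn]
  ring_nf
  simp

/-- Take `N` to be the average of the two output laws. Then `P true ≤ 2 N`, so its density lies in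
`[0, 2]`, and `P true + P false = 2 N` forces the density of `P false`. -/
theorem exists_isTilt {Y : Type*} [MeasurableSpace Y] (P : Kernel Bool Y) [IsMarkovKernel P] :
    ∃ (N : Measure Y) (η : Y → ℝ), IsProbabilityMeasure N ∧ IsTilt P N η := by
  set N : Measure Y := (2⁻¹ : ℝ≥0∞) • (P true + P false) with hN
  have hprob : IsProbabilityMeasure N := ⟨by
    simp only [hN, Measure.smul_apply, Measure.add_apply, measure_univ, smul_eq_mul]
    rw [one_add_one_eq_two, ENNReal.inv_mul_cancel (by norm_num) (by norm_num)]⟩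
  have h2N : (2 : ℝ≥0∞) • N = P true + P false := by
    rw [hN, smul_smul, ENNReal.mul_inv_cancel (by norm_num) (by norm_num), one_smul]
  have hle : P true ≤ (2 : ℝ≥0∞) • N := by
    rw [h2N]; exact Measure.le_add_right le_rfl
  have hac : P true ≪ N :=
    (Measure.absolutelyContinuous_of_le hle).trans Measure.smul_absolutelyContinuous
  set p := (P true).rnDeriv N with hp
  have hpm : Measurable p := Measure.measurable_rnDeriv _ _
  have hp2 : ∀ᵐ y ∂N, p y ≤ 2 := by
    refine ae_le_of_forall_setLIntegral_le_of_sigmaFinite hpm fun s hs _ => ?_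
    rw [Measure.setLIntegral_rnDeriv hac, setLIntegral_const]
    exact hle s
  -- The density bound holds only almost everywhere; truncation makes `|η| ≤ 1` hold at every point.
  set η : Y → ℝ := fun y => max (-1) (min 1 ((p y).toReal - 1)) with hη
  have hηm : Measurable η := by fun_prop
  have hη1 : ∀ y, |η y| ≤ 1 := fun y =>
    abs_le.2 ⟨le_max_left _ _, max_le (by norm_num) (min_le_left _ _)⟩
  have ht : P true = N.withDensity fun y => ENNReal.ofReal (1 + sgn true * η y) := by
    rw [← Measure.withDensity_rnDeriv_eq _ _ hac]
    refine withDensity_congr_ae ?_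
    filter_upwards [hp2] with y hy
    have hfin : p y ≠ ∞ := ne_top_of_le_ne_top (by norm_num) hy
    have h2 : (p y).toReal ≤ 2 := ENNReal.toReal_le_of_le_ofReal (by norm_num) (by simpa using hy)
    have h0 : 0 ≤ (p y).toReal := ENNReal.toReal_nonneg
    have : η y = (p y).toReal - 1 := by
      rw [hη]
      simp only
      rw [min_eq_right (by linarith), max_eq_right (by linarith)]
    simp only [sgn, this]
    rw [one_mul, add_sub_cancel, ENNReal.ofReal_toReal hfin]
  refine ⟨N, η, hprob, hηm, hη1, fun b => ?_⟩
  cases b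
  · have h := withDensity_one_add_sub N hηm hη1
    rw [h2N, ← ht] at h
    ext E hE
    have hE2 := congrArg (fun μ : Measure Y => μ E) h
    simp only [Measure.add_apply] at hE2
    exact ((ENNReal.add_right_inj (measure_ne_top _ _)).1 hE2).symm
  · exact ht

theorem uniform_apply_singleton (b : Bool) :
    (PMF.uniformOfFintype Bool).toMeasure {b} = 2⁻¹ := by
  rw [PMF.toMeasure_apply_singleton _ _ (measurableSet_singleton b)]
  simp

theorem IsTilt.bind_uniform {Y : Type*} [MeasurableSpace Y] {P : Kernel Bool Y}
    {N : Measure Y} {η : Y → ℝ} (h : IsTilt P N η) :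
    P ∘ₘ (PMF.uniformOfFintype Bool).toMeasure = N := by
  ext E hE
  rw [Measure.bind_apply hE P.aemeasurable, lintegral_fintype]
  simp only [Fintype.sum_bool, uniform_apply_singleton]
  rw [← add_mul, ← Measure.add_apply, h.eq_withDensity true, h.eq_withDensity false,
    withDensity_one_add_sub N h.measurable h.abs_le_one, Measure.smul_apply, smul_eq_mul,
    mul_right_comm, mul_comm, ENNReal.mul_inv_cancel (by norm_num) (by norm_num), mul_one]

/-- The `χ²`-capacity is the second moment of `η`. -/
theorem IsTilt.chiSqCap_eq {Y : Type*} [MeasurableSpace Y] {P : Kernel Bool Y}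
    [IsMarkovKernel P] {N : Measure Y} [IsProbabilityMeasure N] {η : Y → ℝ}
    (h : IsTilt P N η) : chiSqCap P = ∫ y, η y ^ 2 ∂N := by
  set π := (PMF.uniformOfFintype Bool).toMeasure with hπ
  have hηm := h.measurable
  have hsgn : Measurable sgn := measurable_of_countable _
  have hm : Measurable fun z : Bool × Y => ENNReal.ofReal (1 + sgn z.1 * η z.2) := by fun_prop
  -- The joint law has density `1 ± η` relative to the product of its marginals, so the `χ²`
  -- integrand is `η ^ 2` for either input.
  have hcomp : π ⊗ₘ P
      = (π.prod N).withDensity fun z => ENNReal.ofReal (1 + sgn z.1 * η z.2) := by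
    refine Measure.ext_of_lintegral _ fun f hf => ?_
    rw [Measure.lintegral_compProd hf, lintegral_withDensity_eq_lintegral_mul _ hm hf,
      lintegral_prod _ (hm.mul hf).aemeasurable]
    refine lintegral_congr fun b => ?_
    rw [h.eq_withDensity b, lintegral_withDensity_eq_lintegral_mul _
      (h.measurable_density b).ennreal_ofReal (by fun_prop)]
    rfl
  unfold chiSqCap chiSqInfo chiSqDiv
  rw [← hπ, h.bind_uniform, hcomp, if_pos (withDensity_absolutelyContinuous _ _)]
  have hr : ∫⁻ z, ENNReal.ofReal (((((π.prod N).withDensity fun z =>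
        ENNReal.ofReal (1 + sgn z.1 * η z.2)).rnDeriv (π.prod N) z).toReal - 1) ^ 2) ∂(π.prod N)
      = ∫⁻ z, ENNReal.ofReal (η z.2 ^ 2) ∂(π.prod N) := by
    refine lintegral_congr_ae ?_
    filter_upwards [Measure.rnDeriv_withDensity (π.prod N) hm] with z hz
    rw [hz, ENNReal.toReal_ofReal (one_add_sgn_mul_nonneg (h.abs_le_one _) _)]
    congr 1
    rcases z with ⟨b, y⟩
    cases b <;> simp [sgn]
  rw [hr, lintegral_prod _ (by fun_prop)]
  simp only [lintegral_const, measure_univ, mul_one]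
  rw [
    integral_eq_lintegral_of_nonneg_ae (Filter.Eventually.of_forall fun y => sq_nonneg _)
      (by fun_prop)]

theorem IsTilt.integrable {Y : Type*} [MeasurableSpace Y] {P : Kernel Bool Y}
    {N : Measure Y} [IsProbabilityMeasure N] {η : Y → ℝ} (h : IsTilt P N η) :
    Integrable η N :=
  Integrable.of_bound h.measurable.aestronglyMeasurable 1
    (Filter.Eventually.of_forall fun y => by simpa using h.abs_le_one y)

theorem IsTilt.integrable_sq {Y : Type*} [MeasurableSpace Y] {P : Kernel Bool Y}
    {N : Measure Y} [IsProbabilityMeasure N] {η : Y → ℝ} (h : IsTilt P N η) :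
    Integrable (fun y => η y ^ 2) N :=
  Integrable.of_bound (h.measurable.pow_const 2).aestronglyMeasurable 1
    (Filter.Eventually.of_forall fun y => by
      rw [norm_pow, Real.norm_eq_abs]
      exact pow_le_one₀ (abs_nonneg _) (h.abs_le_one y))

theorem IsTilt.integral_eq_zero {Y : Type*} [MeasurableSpace Y] {P : Kernel Bool Y}
    [IsMarkovKernel P] {N : Measure Y} [IsProbabilityMeasure N] {η : Y → ℝ}
    (h : IsTilt P N η) : ∫ y, η y ∂N = 0 := by
  have h1 : ∫ _, (1 : ℝ) ∂(P true) = 1 := by simp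
  rw [h.eq_withDensity true, integral_withDensity_ofReal N (h.measurable_density _)
    (fun y => one_add_sgn_mul_nonneg (h.abs_le_one y) _)] at h1
  simp only [sgn, one_mul, smul_eq_mul, mul_one] at h1
  rw [integral_add (integrable_const _) h.integrable] at h1
  simpa using h1

/-- Under input `+` the density is `1 + η`, and `η` has mean zero under `N`. This trades the second
moment for a mean under one input, where `L` is a sum of independent terms. -/
theorem IsTilt.integral_sq_eq {Y : Type*} [MeasurableSpace Y] {P : Kernel Bool Y}
    [IsMarkovKernel P] {N : Measure Y} [IsProbabilityMeasure N] {η : Y → ℝ}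
    (h : IsTilt P N η) : ∫ y, η y ^ 2 ∂N = ∫ y, η y ∂(P true) := by
  rw [h.eq_withDensity true, integral_withDensity_ofReal N (h.measurable_density _)
    (fun y => one_add_sgn_mul_nonneg (h.abs_le_one y) _)]
  have : ∀ y, (1 + sgn true * η y) • η y = η y + η y ^ 2 := fun y => by
    simp only [sgn, smul_eq_mul]; ring
  simp only [this]
  rw [integral_add h.integrable h.integrable_sq, h.integral_eq_zero, zero_add]

theorem tanh_half_log_sub_log {x y : ℝ} (hx : 0 < x) (hy : 0 < y) :
    Real.tanh ((Real.log x - Real.log y) / 2) = (x - y) / (x + y) := by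
  set u := (Real.log x - Real.log y) / 2 with hu
  have h : Real.exp (2 * u) = x / y := by
    rw [hu, mul_div_cancel₀ _ two_ne_zero, Real.exp_sub, Real.exp_log hx, Real.exp_log hy]
  have hx' : x = y * (Real.exp u * Real.exp u) := by
    rw [← Real.exp_add, ← two_mul, h]; field_simp
  have he := Real.exp_pos u
  rw [Real.tanh_eq_sinh_div_cosh, Real.sinh_eq, Real.cosh_eq, Real.exp_neg, hx']
  field_simp

/-- The `χ²`-capacity as the mean of `tanh` of half the log-likelihood ratio. -/
theorem chiSqCap_eq_integral_tanh {Z : Type*} [MeasurableSpace Z] (W : Kernel Bool Z)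
    [IsMarkovKernel W] (R : Measure Z) {F : Bool → Z → ℝ}
    (hF : ∀ b, Measurable (F b)) (hpos : ∀ b z, 0 < F b z)
    (hW : ∀ b, W b = R.withDensity fun z => ENNReal.ofReal (F b z)) :
    chiSqCap W = ∫ z, Real.tanh ((Real.log (F true z) - Real.log (F false z)) / 2) ∂(W true) := by
  have hFt := hF true
  have hFf := hF false
  set η : Z → ℝ := fun z => (F true z - F false z) / (F true z + F false z) with hη
  -- `N` is the average output law, and relative to it the tilt is the normalized difference of the
  -- densities, which is `tanh` of half the log-likelihood ratio.
  set N := R.withDensity fun z => ENNReal.ofReal ((F true z + F false z) / 2) with hN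
  have hηm : Measurable η := by fun_prop
  have hη1 : ∀ z, |η z| ≤ 1 := fun z => by
    have h1 := hpos true z
    have h2 := hpos false z
    rw [hη, abs_div, abs_of_pos (add_pos h1 h2)]
    refine div_le_one_of_le₀ (abs_le.2 ⟨?_, ?_⟩) (add_pos h1 h2).le <;> linarith
  have htilt : IsTilt W N η := by
    refine ⟨hηm, hη1, fun b => ?_⟩
    rw [hN, ← withDensity_mul _ (by fun_prop) (by fun_prop), hW b]
    congr 1
    ext z
    have h1 := hpos true z
    have h2 := hpos false z
    rw [Pi.mul_apply, ← ENNReal.ofReal_mul (by positivity)]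
    congr 1
    have h3 : F true z + F false z ≠ 0 := (add_pos h1 h2).ne'
    cases b <;> simp only [sgn, hη] <;> field_simp <;> ring
  have : IsProbabilityMeasure N := ⟨by
    have h := congrArg (fun μ : Measure Z => μ Set.univ)
      (withDensity_one_add_sub N hηm hη1)
    rw [← htilt.eq_withDensity, ← htilt.eq_withDensity] at h
    simp only [Measure.add_apply, measure_univ, Measure.smul_apply, smul_eq_mul] at h
    rw [one_add_one_eq_two] at h
    exact ((ENNReal.mul_eq_left (by norm_num) (by norm_num)).1 h.symm)⟩
  rw [htilt.chiSqCap_eq, htilt.integral_sq_eq]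
  refine integral_congr_ae (Filter.Eventually.of_forall fun z => ?_)
  exact (tanh_half_log_sub_log (hpos true z) (hpos false z)).symm

/-! ### Densities of product measures -/

theorem lintegral_pi_prod {ι : Type*} [Fintype ι] {α : ι → Type*} [∀ i, MeasurableSpace (α i)]
    (μ : ∀ i, Measure (α i)) [∀ i, IsProbabilityMeasure (μ i)] {f : ∀ i, α i → ℝ≥0∞}
    (hf : ∀ i, Measurable (f i)) :
    ∫⁻ x, ∏ i, f i (x i) ∂(Measure.pi μ) = ∏ i, ∫⁻ y, f i y ∂(μ i) := by
  refine (lintegral_prod_eq_prod_lintegral_of_indepFun Finset.univ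
    (fun i (x : ∀ i, α i) => f i (x i))
    (iIndepFun_pi fun i => (hf i).aemeasurable)
    fun i => (hf i).comp (measurable_pi_apply i)).trans ?_
  refine Finset.prod_congr rfl fun i _ => ?_
  exact (measurePreserving_eval μ i).lintegral_comp (hf i)

/-- It is enough to test on boxes, where the indicator times the product density factors over
coordinates. -/
theorem pi_withDensity {ι : Type*} [Fintype ι] {α : ι → Type*} [∀ i, MeasurableSpace (α i)]
    (μ : ∀ i, Measure (α i)) [∀ i, IsProbabilityMeasure (μ i)] {f : ∀ i, α i → ℝ≥0∞}
    (hf : ∀ i, Measurable (f i)) [∀ i, SigmaFinite ((μ i).withDensity (f i))] :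
    Measure.pi (fun i => (μ i).withDensity (f i))
      = (Measure.pi μ).withDensity fun x => ∏ i, f i (x i) := by
  classical
  refine Measure.pi_eq fun s hs => ?_
  rw [withDensity_apply _ (MeasurableSet.univ_pi hs), ← lintegral_indicator
    (MeasurableSet.univ_pi hs)]
  have : ∀ x, (Set.univ.pi s).indicator (fun x => ∏ i, f i (x i)) x
      = ∏ i, (s i).indicator (f i) (x i) := fun x => by
    by_cases hx : x ∈ Set.univ.pi s
    · rw [Set.indicator_of_mem hx]
      exact Finset.prod_congr rfl fun i _ => (Set.indicator_of_mem (hx i trivial) _).symm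
    · rw [Set.indicator_of_notMem hx]
      simp only [Set.mem_pi, Set.mem_univ, true_imp_iff, not_forall] at hx
      obtain ⟨i, hi⟩ := hx
      exact (Finset.prod_eq_zero (Finset.mem_univ i) (Set.indicator_of_notMem hi _)).symm
  simp only [this]
  rw [lintegral_pi_prod μ fun i => (hf i).indicator (hs i)]
  refine Finset.prod_congr rfl fun i _ => ?_
  rw [lintegral_indicator (hs i), withDensity_apply _ (hs i)]

/-! ### The broadcasting step -/

/-- The density of the channel `P^{× n} ∘ B` with respect to `N^{⊗ n}`. -/
def childDensity {Y : Type*} (n : ℕ) (lam : ℝ) (η : Y → ℝ) (b : Bool) (y : Fin n → Y) : ℝ :=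
  1 - lam + lam * ∏ i, (1 + sgn b * η (y i))

theorem sum_prod_one_add_sgn {n : ℕ} (u : Fin n → ℝ) :
    ∑ x : Fin n → Bool, ∏ i, (1 + sgn (x i) * u i) = 2 ^ n := by
  have h := Finset.prod_univ_sum (fun _ : Fin n => (Finset.univ : Finset Bool))
    (fun i b => 1 + sgn b * u i)
  rw [Fintype.piFinset_univ] at h
  rw [← h]
  have : ∀ i, ∑ b : Bool, (1 + sgn b * u i) = 2 := fun i => by
    simp only [Fintype.sum_bool, sgn]; ring
  simp only [this, Finset.prod_const, Finset.card_univ, Fintype.card_fin]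

/-- The broadcast law puts weight `lam` on the constant string `b` and spreads `1 - lam` over
uniform strings. Averaging over uniform signs removes the tilt in each factor and leaves 1. -/
theorem childDensity_eq_sum {Y : Type*} (r : ℕ) (lam : ℝ) (η : Y → ℝ) (b : Bool)
    (y : Fin (r - 1) → Y) :
    childDensity (r - 1) lam η b y
      = ∑ x, broadcastProb r lam b x * ∏ i, (1 + sgn (x i) * η (y i)) := by
  have h : ∀ x : Fin (r - 1) → Bool, broadcastProb r lam b x
      = (if x = (fun _ => b) then lam else 0) + 1 / 2 ^ (r - 1) * (1 - lam) := fun x => by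
    unfold broadcastProb
    simp only [funext_iff]
    split_ifs <;> ring
  simp only [h, add_mul, Finset.sum_add_distrib, ite_mul, zero_mul, Finset.sum_ite_eq',
    Finset.mem_univ, if_true]
  rw [← Finset.mul_sum, sum_prod_one_add_sgn, childDensity]
  field_simp
  ring

theorem broadcastProb_nonneg (r : ℕ) {lam : ℝ} (hlam : lam ∈ Set.Icc (0 : ℝ) 1) (b : Bool)
    (x : Fin (r - 1) → Bool) : 0 ≤ broadcastProb r lam b x := by
  have h0 := hlam.1
  have : 0 ≤ 1 - lam := by linarith [hlam.2]
  unfold broadcastProb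
  split_ifs <;> positivity

theorem tensorPow_eq_withDensity {Y : Type*} [MeasurableSpace Y] {P : Kernel Bool Y}
    [IsMarkovKernel P] {N : Measure Y} [IsProbabilityMeasure N] {η : Y → ℝ}
    (h : IsTilt P N η) (n : ℕ) (x : Fin n → Bool) :
    tensorPow P n x = (Measure.pi fun _ : Fin n => N).withDensity fun y =>
      ENNReal.ofReal (∏ i, (1 + sgn (x i) * η (y i))) := by
  have hs : ∀ i, SigmaFinite (N.withDensity fun y =>
      ENNReal.ofReal (1 + sgn (x i) * η y)) := fun i => by
    rw [← h.eq_withDensity]; infer_instance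
  change Measure.pi (fun i => P (x i)) = _
  simp only [h.eq_withDensity]
  rw [pi_withDensity (fun _ => N) fun i => (h.measurable_density (x i)).ennreal_ofReal]
  congr 1
  ext y
  rw [ENNReal.ofReal_prod_of_nonneg fun i _ => one_add_sgn_mul_nonneg (h.abs_le_one _) _]

theorem comp_broadcast_eq_withDensity {Y : Type*} [MeasurableSpace Y] {P : Kernel Bool Y}
    [IsMarkovKernel P] {N : Measure Y} [IsProbabilityMeasure N] {η : Y → ℝ}
    (h : IsTilt P N η) (r : ℕ) {lam : ℝ} (hlam : lam ∈ Set.Icc (0 : ℝ) 1) (b : Bool) :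
    (tensorPow P (r - 1) ∘ₖ broadcast r lam) b
      = (Measure.pi fun _ : Fin (r - 1) => N).withDensity fun y =>
          ENNReal.ofReal (childDensity (r - 1) lam η b y) := by
  have hηm := h.measurable
  ext E hE
  rw [Kernel.comp_apply, Measure.bind_apply hE (Kernel.aemeasurable _)]
  change ∫⁻ x, tensorPow P (r - 1) x E ∂(∑ x : Fin (r - 1) → Bool,
    ENNReal.ofReal (broadcastProb r lam b x) • Measure.dirac x) = _
  rw [lintegral_finsetSum_measure, withDensity_apply _ hE]
  simp only [lintegral_smul_measure, lintegral_dirac, smul_eq_mul]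
  have hd : ∀ y, ENNReal.ofReal (childDensity (r - 1) lam η b y)
      = ∑ x, ENNReal.ofReal (broadcastProb r lam b x)
          * ENNReal.ofReal (∏ i, (1 + sgn (x i) * η (y i))) := fun y => by
    rw [childDensity_eq_sum, ENNReal.ofReal_sum_of_nonneg]
    · exact Finset.sum_congr rfl fun x _ =>
        ENNReal.ofReal_mul (broadcastProb_nonneg r hlam b x)
    · exact fun x _ => mul_nonneg (broadcastProb_nonneg r hlam b x)
        (Finset.prod_nonneg fun i _ => one_add_sgn_mul_nonneg (h.abs_le_one _) _)
  simp only [hd]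
  rw [lintegral_finsetSum _ fun x _ => by fun_prop]
  refine Finset.sum_congr rfl fun x _ => ?_
  rw [lintegral_const_mul _ (by fun_prop), tensorPow_eq_withDensity h, withDensity_apply _ hE]

/-! ### Mixtures of star powers -/

theorem measurable_sigmaMk {Y : ℕ → Type*} [∀ t, MeasurableSpace (Y t)] (t : ℕ) :
    Measurable (Sigma.mk t : Y t → Σ t, Y t) := fun _ hu =>
  (MeasurableSpace.measurableSet_iInf.1 hu) t

theorem measurable_sigma_iff {Y : ℕ → Type*} [∀ t, MeasurableSpace (Y t)] {β : Type*}
    [MeasurableSpace β] {f : (Σ t, Y t) → β} :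
    Measurable f ↔ ∀ t, Measurable fun y => f ⟨t, y⟩ :=
  ⟨fun h t => h.comp (measurable_sigmaMk t), fun h _ hu =>
    MeasurableSpace.measurableSet_iInf.2 fun t => h t hu⟩

theorem lintegral_mixture {X : Type*} {Y : ℕ → Type*} [MeasurableSpace X] [Countable X]
    [MeasurableSingletonClass X] [∀ t, MeasurableSpace (Y t)] (D : Measure ℕ)
    (K : ∀ t, Kernel X (Y t)) (x : X) {f : (Σ t, Y t) → ℝ≥0∞} (hf : Measurable f) :
    ∫⁻ z, f z ∂(mixture D K x) = ∑' t, D {t} * ∫⁻ y, f ⟨t, y⟩ ∂(K t x) := by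
  change ∫⁻ z, f z ∂(Measure.sum fun t => D {t} • (K t x).map (Sigma.mk t)) = _
  rw [lintegral_sum_measure]
  refine tsum_congr fun t => ?_
  rw [lintegral_smul_measure, lintegral_map hf (measurable_sigmaMk t), smul_eq_mul]

theorem integral_mixture {X : Type*} {Y : ℕ → Type*} [MeasurableSpace X] [Countable X]
    [MeasurableSingletonClass X] [∀ t, MeasurableSpace (Y t)] (D : Measure ℕ)
    (K : ∀ t, Kernel X (Y t)) (x : X) {f : (Σ t, Y t) → ℂ} (hf : Measurable f)
    (hi : Integrable f (mixture D K x)) :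
    ∫ z, f z ∂(mixture D K x) = ∑' t, D.real {t} • ∫ y, f ⟨t, y⟩ ∂(K t x) := by
  change ∫ z, f z ∂(Measure.sum fun t => D {t} • (K t x).map (Sigma.mk t)) = _
  rw [integral_sum_measure hi]
  refine tsum_congr fun t => ?_
  rw [integral_smul_measure, integral_map (measurable_sigmaMk t).aemeasurable
    hf.aestronglyMeasurable]
  rfl

/-- The product density on the disjoint union of all powers of `Z`. -/
def starDensity {Z : Type*} (q : Z → ℝ) (z : Σ t : ℕ, Fin t → Z) : ℝ := ∏ j, q (z.2 j)

theorem measurable_starDensity {Z : Type*} [MeasurableSpace Z] {q : Z → ℝ} (hq : Measurable q) :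
    Measurable (starDensity q) :=
  measurable_sigma_iff.2 fun t => by
    exact Finset.measurable_prod Finset.univ (f := fun j (y : Fin t → Z) => q (y j))
      fun j _ => hq.comp (measurable_pi_apply j)

/-- Since `t` is drawn independently of the input, the weights of `D` go into the reference measure
and do not enter the likelihood. The reference channel is constant, so its input `true` is
arbitrary. -/
theorem mixture_starPow_eq_withDensity {Z : Type*} [MeasurableSpace Z] (W : Kernel Bool Z)
    [IsMarkovKernel W] (R : Measure Z) [IsProbabilityMeasure R] {q : Bool → Z → ℝ}
    (hq : ∀ b, Measurable (q b)) (hpos : ∀ b z, 0 < q b z)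
    (hW : ∀ b, W b = R.withDensity fun z => ENNReal.ofReal (q b z)) (D : Measure ℕ) (b : Bool) :
    mixture D (starPow W) b
      = (mixture D (starPow (Kernel.const Bool R)) true).withDensity fun z =>
          ENNReal.ofReal (starDensity (q b) z) := by
  have hm := (measurable_starDensity (hq b)).ennreal_ofReal
  have hs : SigmaFinite (R.withDensity fun z => ENNReal.ofReal (q b z)) := by
    rw [← hW]; infer_instance
  have hstar : ∀ t, starPow W t b = (starPow (Kernel.const Bool R) t true).withDensity fun y =>
      ENNReal.ofReal (starDensity (q b) ⟨t, y⟩) := fun t => by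
    change Measure.pi (fun _ => W b) = (Measure.pi fun _ => R).withDensity _
    rw [hW b, pi_withDensity (fun _ => R) fun _ => (hq b).ennreal_ofReal]
    congr 1
    ext y
    rw [starDensity, ENNReal.ofReal_prod_of_nonneg fun i _ => (hpos b _).le]
  refine Measure.ext_of_lintegral _ fun f hf => ?_
  rw [lintegral_withDensity_eq_lintegral_mul _ hm hf, lintegral_mixture D _ _ hf,
    lintegral_mixture D _ _ (hm.mul hf)]
  refine tsum_congr fun t => ?_
  rw [hstar t]
  congr 1
  exact lintegral_withDensity_eq_lintegral_mul _ (hm.comp (measurable_sigmaMk t))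
    (hf.comp (measurable_sigmaMk t))

/-! ### Half log-likelihood ratios and their characteristic functions -/

/-- Half the log-likelihood ratio of a channel with densities `q`. -/
noncomputable def halfLLR {Z : Type*} (q : Bool → Z → ℝ) (z : Z) : ℝ :=
  (Real.log (q true z) - Real.log (q false z)) / 2

theorem measurable_halfLLR {Z : Type*} [MeasurableSpace Z] {q : Bool → Z → ℝ}
    (hq : ∀ b, Measurable (q b)) : Measurable (halfLLR q) := by
  have h1 := hq true
  have h2 := hq false
  unfold halfLLR
  fun_prop

theorem halfLLR_starDensity {Z : Type*} {q : Bool → Z → ℝ} (hpos : ∀ b z, 0 < q b z) (t : ℕ)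
    (y : Fin t → Z) :
    halfLLR (fun b => starDensity (q b)) ⟨t, y⟩ = ∑ j, halfLLR q (y j) := by
  simp only [halfLLR, starDensity]
  rw [Real.log_prod fun j _ => (hpos _ _).ne', Real.log_prod fun j _ => (hpos _ _).ne',
    ← Finset.sum_sub_distrib, Finset.sum_div]

theorem integrable_exp_I_mul {Z : Type*} [MeasurableSpace Z] (μ : Measure Z)
    [IsFiniteMeasure μ] {T : Z → ℝ} (hT : Measurable T) :
    Integrable (fun z => Complex.exp (Complex.I * (T z : ℝ))) μ :=
  Integrable.of_bound (by fun_prop) 1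
    (Filter.Eventually.of_forall fun z => by rw [mul_comm, Complex.norm_exp_ofReal_mul_I])

theorem norm_integral_exp_I_mul_le {Z : Type*} [MeasurableSpace Z] (μ : Measure Z)
    [IsProbabilityMeasure μ] (T : Z → ℝ) :
    ‖∫ z, Complex.exp (Complex.I * (T z : ℝ)) ∂μ‖ ≤ 1 := by
  refine (norm_integral_le_of_norm_le_const (C := 1)
    (Filter.Eventually.of_forall fun z => ?_)).trans (by simp)
  rw [mul_comm, Complex.norm_exp_ofReal_mul_I]

/-- Given `t`, the ratio is a sum of `t` i.i.d. copies, so conditioning on `t` yields the generating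
function of `D` at the characteristic function of one copy. -/
theorem charFun_halfLLR_mixture {Z : Type*} [MeasurableSpace Z] (W : Kernel Bool Z)
    [IsMarkovKernel W] {q : Bool → Z → ℝ} (hq : ∀ b, Measurable (q b))
    (hpos : ∀ b z, 0 < q b z) (D : Measure ℕ) [IsProbabilityMeasure D] (ξ : ℝ) :
    charFun ((mixture D (starPow W) true).map (halfLLR fun b => starDensity (q b))) ξ
      = ∫ t, (∫ z, Complex.exp (Complex.I * (ξ * halfLLR q z : ℝ)) ∂(W true)) ^ t ∂D := by
  set φ := ∫ z, Complex.exp (Complex.I * (ξ * halfLLR q z : ℝ)) ∂(W true) with hφ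
  have hT : Measurable (halfLLR fun b => starDensity (q b)) :=
    measurable_halfLLR fun b => measurable_starDensity (hq b)
  have hφ1 : ‖φ‖ ≤ 1 := norm_integral_exp_I_mul_le _ _
  rw [charFun_apply_real, integral_map hT.aemeasurable (by fun_prop)]
  have he : ∀ z, Complex.exp ((ξ : ℂ) * (halfLLR (fun b => starDensity (q b)) z : ℝ) * Complex.I)
      = Complex.exp (Complex.I * (ξ * halfLLR (fun b => starDensity (q b)) z : ℝ)) := fun z => by
    congr 1; push_cast; ring
  simp only [he]
  rw [integral_mixture D _ _ (by fun_prop) (integrable_exp_I_mul _ (hT.const_mul ξ)),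
    integral_countable]
  · refine tsum_congr fun t => ?_
    congr 1
    simp only [halfLLR_starDensity hpos]
    change ∫ y : Fin t → Z, _ ∂(Measure.pi fun _ => W true) = _
    have : ∀ y : Fin t → Z, Complex.exp (Complex.I * (ξ * ∑ j, halfLLR q (y j) : ℝ))
        = ∏ j, Complex.exp (Complex.I * (ξ * halfLLR q (y j) : ℝ)) := fun y => by
      rw [← Complex.exp_sum]
      congr 1
      push_cast
      rw [Finset.mul_sum, Finset.mul_sum]
    simp only [this]
    rw [integral_fintype_prod_eq_pow (fun z => Complex.exp (Complex.I * (ξ * halfLLR q z : ℝ))),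
      Fintype.card_fin]
  · refine Integrable.of_bound (by fun_prop) 1 (Filter.Eventually.of_forall fun t => ?_)
    rw [norm_pow]
    exact pow_le_one₀ (norm_nonneg _) hφ1

/-! ### Second-order expansion for one child hyperedge -/

section Child

variable {Y : Type*} [MeasurableSpace Y] {P : Kernel Bool Y} {N : Measure Y} {η : Y → ℝ}

theorem IsTilt.prod_mem_Icc (h : IsTilt P N η) {n : ℕ} (b : Bool) (y : Fin n → Y) :
    ∏ i, (1 + sgn b * η (y i)) ∈ Set.Icc (0 : ℝ) (2 ^ n) := by
  refine ⟨Finset.prod_nonneg fun i _ => one_add_sgn_mul_nonneg (h.abs_le_one _) _, ?_⟩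
  calc ∏ i, (1 + sgn b * η (y i)) ≤ ∏ _i : Fin n, (2 : ℝ) := by
        refine Finset.prod_le_prod (fun i _ => one_add_sgn_mul_nonneg (h.abs_le_one _) _) fun i _ => ?_
        obtain ⟨h1, h2⟩ := abs_le.1 (h.abs_le_one (y i))
        cases b <;> simp only [sgn] <;> linarith
    _ = 2 ^ n := by simp

/-- The deviation is `lam` times a factor bounded in terms of `n` only. This is the smallness,
uniform in `P`, behind the Taylor expansion. -/
theorem IsTilt.abs_childDensity_sub_one_le (h : IsTilt P N η) {n : ℕ} {lam : ℝ}
    (hlam : 0 ≤ lam) (b : Bool) (y : Fin n → Y) :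
    |childDensity n lam η b y - 1| ≤ lam * 2 ^ n := by
  obtain ⟨h0, h1⟩ := h.prod_mem_Icc b y
  have h2 : (1 : ℝ) ≤ 2 ^ n := one_le_pow₀ (by norm_num)
  have : childDensity n lam η b y - 1 = lam * (∏ i, (1 + sgn b * η (y i)) - 1) := by
    unfold childDensity; ring
  rw [this, abs_mul, abs_of_nonneg hlam]
  gcongr
  rw [abs_le]
  constructor <;> linarith

theorem IsTilt.measurable_childDensity (h : IsTilt P N η) (n : ℕ) (lam : ℝ) (b : Bool) :
    Measurable (childDensity n lam η b : (Fin n → Y) → ℝ) := by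
  have : Measurable fun y : Fin n → Y => ∏ i, (1 + sgn b * η (y i)) :=
    Finset.measurable_prod _ fun i _ => (h.measurable_density b).comp (measurable_pi_apply i)
  unfold childDensity
  fun_prop

variable [IsMarkovKernel P] [IsProbabilityMeasure N]

theorem IsTilt.integral_childDensity (h : IsTilt P N η) (n : ℕ) (lam : ℝ) (b : Bool) :
    ∫ y, childDensity n lam η b y ∂(Measure.pi fun _ : Fin n => N) = 1 := by
  have hm : Measurable fun y : Fin n → Y => ∏ i, (1 + sgn b * η (y i)) :=
    Finset.measurable_prod _ fun i _ => (h.measurable_density b).comp (measurable_pi_apply i)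
  have hi : Integrable (fun y : Fin n → Y => ∏ i, (1 + sgn b * η (y i)))
      (Measure.pi fun _ : Fin n => N) :=
    Integrable.of_bound hm.aestronglyMeasurable (2 ^ n) (Filter.Eventually.of_forall fun y => by
      rw [Real.norm_eq_abs, abs_of_nonneg (h.prod_mem_Icc b y).1]
      exact (h.prod_mem_Icc b y).2)
  unfold childDensity
  rw [integral_add (integrable_const _) (hi.const_mul lam), integral_const_mul,
    integral_fintype_prod_eq_pow (fun y => 1 + sgn b * η y),
    integral_add (integrable_const _) (h.integrable.const_mul _), integral_const_mul,
    h.integral_eq_zero]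
  simp

/-- Expanding the square leaves products over coordinates of `(1 + η) ^ 2`, `(1 - η) ^ 2` and `1 - η
^ 2`. As `η` has mean zero and second moment `C = chiSqCap P`, each factor has mean `1 + C`, `1 + C`
and `1 - C`. -/
theorem IsTilt.integral_childDensity_sub_sq (h : IsTilt P N η) (n : ℕ) (lam : ℝ) :
    ∫ y, (childDensity n lam η true y - childDensity n lam η false y) ^ 2 / 4
        ∂(Measure.pi fun _ : Fin n => N)
      = lam ^ 2 * (1 / 2 * ((1 + chiSqCap P) ^ n - (1 - chiSqCap P) ^ n)) := by
  have hηm := h.measurable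
  have hcap := h.chiSqCap_eq
  have hint : ∀ {v : Y → ℝ}, Measurable v → (∀ y, |v y| ≤ 4) →
      Integrable (fun y : Fin n → Y => ∏ i, v (y i)) (Measure.pi fun _ : Fin n => N) :=
    fun {v} hv hb => Integrable.of_bound
      (Finset.measurable_prod _ fun i _ => hv.comp (measurable_pi_apply i)).aestronglyMeasurable
      (∏ _i : Fin n, 4) (Filter.Eventually.of_forall fun y => by
        rw [norm_prod]
        exact Finset.prod_le_prod (fun i _ => norm_nonneg _) fun i _ => hb _)
  have hpt : ∀ y : Fin n → Y,
      (childDensity n lam η true y - childDensity n lam η false y) ^ 2 / 4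
        = lam ^ 2 / 4 * ((∏ i, (1 + 2 * η (y i) + η (y i) ^ 2)
            + ∏ i, (1 - 2 * η (y i) + η (y i) ^ 2)) - 2 * ∏ i, (1 - η (y i) ^ 2)) := fun y => by
    have e1 : ∏ i, (1 + 2 * η (y i) + η (y i) ^ 2) = (∏ i, (1 + η (y i))) ^ 2 := by
      rw [← Finset.prod_pow]; exact Finset.prod_congr rfl fun i _ => by ring
    have e2 : ∏ i, (1 - 2 * η (y i) + η (y i) ^ 2) = (∏ i, (1 - η (y i))) ^ 2 := by
      rw [← Finset.prod_pow]; exact Finset.prod_congr rfl fun i _ => by ring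
    have e3 : ∏ i, (1 - η (y i) ^ 2) = (∏ i, (1 + η (y i))) * ∏ i, (1 - η (y i)) := by
      rw [← Finset.prod_mul_distrib]; exact Finset.prod_congr rfl fun i _ => by ring
    rw [e1, e2, e3]
    simp only [childDensity, sgn, one_mul, neg_mul, ← sub_eq_add_neg]
    ring
  have hb : ∀ y, |η y| ≤ 1 ∧ 0 ≤ η y ^ 2 ∧ η y ^ 2 ≤ 1 := fun y =>
    ⟨h.abs_le_one y, sq_nonneg _, (sq_le_one_iff_abs_le_one _).2 (h.abs_le_one y)⟩
  have i1 := hint (v := fun y => 1 + 2 * η y + η y ^ 2) (by fun_prop) fun y => by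
    obtain ⟨h1, h2, h3⟩ := hb y
    rw [abs_le] at h1 ⊢
    constructor <;> linarith [h1.1, h1.2]
  have i2 := hint (v := fun y => 1 - 2 * η y + η y ^ 2) (by fun_prop) fun y => by
    obtain ⟨h1, h2, h3⟩ := hb y
    rw [abs_le] at h1 ⊢
    constructor <;> linarith [h1.1, h1.2]
  have i3 := hint (v := fun y => 1 - η y ^ 2) (by fun_prop) fun y => by
    obtain ⟨h1, h2, h3⟩ := hb y
    rw [abs_le]
    constructor <;> linarith
  have v1 : ∫ y, (1 + 2 * η y + η y ^ 2) ∂N = 1 + chiSqCap P := by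
    have j : Integrable (fun y => 1 + 2 * η y) N :=
      (integrable_const _).add (h.integrable.const_mul _)
    rw [integral_add j h.integrable_sq,
      integral_add (integrable_const _) (h.integrable.const_mul _), integral_const_mul,
      h.integral_eq_zero, hcap]
    simp
  have v2 : ∫ y, (1 - 2 * η y + η y ^ 2) ∂N = 1 + chiSqCap P := by
    have j : Integrable (fun y => 1 - 2 * η y) N :=
      (integrable_const _).sub (h.integrable.const_mul _)
    rw [integral_add j h.integrable_sq,
      integral_sub (integrable_const _) (h.integrable.const_mul _), integral_const_mul,
      h.integral_eq_zero, hcap]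
    simp
  have v3 : ∫ y, (1 - η y ^ 2) ∂N = 1 - chiSqCap P := by
    rw [integral_sub (integrable_const _) h.integrable_sq, hcap]
    simp
  simp only [hpt]
  have i12 : Integrable (fun y : Fin n → Y => ∏ i, (1 + 2 * η (y i) + η (y i) ^ 2)
      + ∏ i, (1 - 2 * η (y i) + η (y i) ^ 2)) (Measure.pi fun _ : Fin n => N) := i1.add i2
  rw [integral_const_mul, integral_sub i12 (i3.const_mul 2), integral_add i1 i2,
    integral_const_mul, integral_fintype_prod_eq_pow (fun y => 1 + 2 * η y + η y ^ 2),
    integral_fintype_prod_eq_pow (fun y => 1 - 2 * η y + η y ^ 2),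
    integral_fintype_prod_eq_pow (fun y => 1 - η y ^ 2), v1, v2, v3, Fintype.card_fin]
  ring

open Complex in
/-- Expansion of the characteristic function of half the log-likelihood ratio of one child
hyperedge. -/
theorem IsTilt.norm_charFun_child_sub_le (h : IsTilt P N η) (r : ℕ) {lam : ℝ}
    (hlam : lam ∈ Set.Icc (0 : ℝ) 1) (hsmall : lam * 2 ^ (r - 1) ≤ 1 / 2) (ξ : ℝ) :
    ‖∫ y, cexp (I * (ξ * halfLLR (childDensity (r - 1) lam η) y : ℝ))
          ∂((tensorPow P (r - 1) ∘ₖ broadcast r lam) true)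
        - (1 + (I * ξ - ξ ^ 2 / 2) * (lam ^ 2 * (1 / 2 *
          ((1 + chiSqCap P) ^ (r - 1) - (1 - chiSqCap P) ^ (r - 1))) : ℝ))‖
      ≤ taylorConst ξ * (lam * 2 ^ (r - 1)) ^ 3 := by
  set n := r - 1
  set Q : Measure (Fin n → Y) := Measure.pi fun _ : Fin n => N
  set q := childDensity n lam η
  have hqm : ∀ b, Measurable (q b) := h.measurable_childDensity n lam
  have hq1 : ∀ b y, |q b y - 1| ≤ lam * 2 ^ n := fun b y =>
    h.abs_childDensity_sub_one_le hlam.1 b y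
  have hqpos : ∀ b y, 0 < q b y := fun b y => by
    linarith [(abs_le.1 ((hq1 b y).trans hsmall)).1]
  have hqi : ∀ b, Integrable (q b) Q := fun b =>
    Integrable.of_bound (hqm b).aestronglyMeasurable 2 (Filter.Eventually.of_forall fun y => by
      obtain ⟨h1, h2⟩ := abs_le.1 ((hq1 b y).trans hsmall)
      rw [Real.norm_eq_abs, abs_le]
      constructor <;> linarith)
  have hLm : Measurable (halfLLR q) := measurable_halfLLR hqm
  have hsqi : Integrable (fun y => (q true y - q false y) ^ 2 / 4) Q := by
    have hm : Measurable fun y => (q true y - q false y) ^ 2 / 4 :=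
      (((hqm true).sub (hqm false)).pow_const 2).div_const 4
    refine Integrable.of_bound hm.aestronglyMeasurable 1 (Filter.Eventually.of_forall fun y => ?_)
    obtain ⟨h1, h2⟩ := abs_le.1 ((hq1 true y).trans hsmall)
    obtain ⟨h3, h4⟩ := abs_le.1 ((hq1 false y).trans hsmall)
    rw [Real.norm_eq_abs, abs_of_nonneg (by positivity)]
    nlinarith
  rw [comp_broadcast_eq_withDensity h r hlam true,
    integral_withDensity_ofReal _ (hqm true) fun y => (hqpos true y).le]
  rw [← h.integral_childDensity_sub_sq n lam]
  have hmain : (1 : ℂ) + (I * ξ - ξ ^ 2 / 2) *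
      ((∫ y, (q true y - q false y) ^ 2 / 4 ∂Q : ℝ) : ℂ)
      = ∫ y, ((q true y : ℂ) + I * ξ * ((q true y - q false y) / 2 : ℝ)
          + (I * ξ - ξ ^ 2 / 2) * ((q true y - q false y) ^ 2 / 4 : ℝ)) ∂Q := by
    have j1 : Integrable (fun y => (q true y : ℂ)) Q := (hqi true).ofReal
    have j2 : Integrable (fun y => (((q true y - q false y) / 2 : ℝ) : ℂ)) Q :=
      (((hqi true).sub (hqi false)).div_const 2).ofReal
    have j3 : Integrable (fun y => (((q true y - q false y) ^ 2 / 4 : ℝ) : ℂ)) Q := hsqi.ofReal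
    -- The first-order term vanishes because both likelihoods have total mass 1.
    have j0 : ∫ y, (q true y - q false y) / 2 ∂Q = 0 := by
      rw [integral_div, integral_sub (hqi true) (hqi false), h.integral_childDensity,
        h.integral_childDensity, sub_self, zero_div]
    have j12 : Integrable (fun y => (q true y : ℂ)
        + I * ξ * ((q true y - q false y) / 2 : ℝ)) Q := j1.add (j2.const_mul _)
    rw [integral_add j12 (j3.const_mul _),
      integral_add j1 (j2.const_mul _), integral_const_mul, integral_const_mul,
      integral_complex_ofReal, integral_complex_ofReal, integral_complex_ofReal,
      j0, h.integral_childDensity]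
    simp
  have hqe : Integrable (fun y => q true y • cexp (I * (ξ * halfLLR q y : ℝ))) Q := by
    refine Integrable.of_bound (by fun_prop) 2 (Filter.Eventually.of_forall fun y => ?_)
    rw [norm_smul, mul_comm I, Complex.norm_exp_ofReal_mul_I, mul_one]
    obtain ⟨h1, h2⟩ := abs_le.1 ((hq1 true y).trans hsmall)
    rw [Real.norm_eq_abs, abs_le]
    constructor <;> linarith
  rw [hmain, ← integral_sub hqe]
  · refine (norm_integral_le_of_norm_le_const (C := taylorConst ξ * (lam * 2 ^ n) ^ 3)
      (Filter.Eventually.of_forall fun y => ?_)).trans (by simp [n])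
    have ht := norm_exp_logRatio_sub_le ξ (hq1 true y) (hq1 false y) hsmall
    simp only [add_sub_cancel, sub_sub_sub_cancel_right] at ht
    simpa only [halfLLR, Complex.real_smul] using ht
  · exact ((hqi true).ofReal.add
      ((((hqi true).sub (hqi false)).div_const 2).ofReal.const_mul _)).add
      (hsqi.ofReal.const_mul _)

end Child

/-! ### Generating functions of the two offspring laws -/

open Complex in
theorem integral_pow_poissonMeasure (d : ℝ≥0) (φ : ℂ) :
    ∫ t, φ ^ t ∂(poissonMeasure d) = cexp (d * (φ - 1)) := by
  rw [integral_poissonMeasure]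
  calc ∑' t : ℕ, (Real.exp (-d) * d ^ t / (t.factorial : ℝ)) • φ ^ t
      = ∑' t : ℕ, (Real.exp (-d) : ℂ) * ((d * φ) ^ t / t.factorial) := by
        congr with t
        rw [Complex.real_smul]
        push_cast
        rw [mul_pow]
        ring
    _ = (Real.exp (-d) : ℂ) * cexp (d * φ) := by
        rw [tsum_mul_left, (NormedSpace.expSeries_div_hasSum_exp ((d : ℂ) * φ)).tsum_eq,
          Complex.exp_eq_exp_ℂ]
    _ = cexp (d * (φ - 1)) := by
        rw [Complex.ofReal_exp, ← Complex.exp_add]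
        congr 1
        push_cast
        ring

-- Both `φ` and `exp z` lie in the unit disc, so their `n`-th powers differ by at most `n` times
-- their distance; the quadratic term is the cost of replacing `1 + z` by `exp z`.
open Complex in
theorem norm_pow_sub_exp_le {φ : ℂ} (hφ : ‖φ‖ ≤ 1) {z : ℂ} (hz : z.re ≤ 0) (n : ℕ) :
    ‖φ ^ n - cexp (n * z)‖ ≤ n * (‖φ - (1 + z)‖ + 3 * ‖z‖ ^ 2) := by
  have he : ‖cexp z‖ ≤ 1 := by
    rw [Complex.norm_exp]
    exact Real.exp_le_one_iff.2 hz
  rw [Complex.exp_nat_mul]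
  refine (norm_pow_sub_pow_le_mul hφ he n).trans ?_
  gcongr
  calc ‖φ - cexp z‖ = ‖(φ - (1 + z)) - (cexp z - 1 - z)‖ := by congr 1; ring
    _ ≤ _ := (norm_sub_le _ _).trans (add_le_add le_rfl (norm_exp_sub_one_sub_le hz))

-- Both exponents have nonpositive real part, where `exp` is 1-Lipschitz. The quadratic term is
-- slack, kept so that both offspring laws satisfy one common bound.
open Complex in
theorem norm_exp_mul_sub_one_sub_exp_le {φ : ℂ} (hφ : ‖φ‖ ≤ 1) {z : ℂ} (hz : z.re ≤ 0)
    (d : ℝ≥0) :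
    ‖cexp (d * (φ - 1)) - cexp (d * z)‖ ≤ d * (‖φ - (1 + z)‖ + 3 * ‖z‖ ^ 2) := by
  have h1 : φ.re ≤ 1 := (Complex.re_le_norm φ).trans hφ
  have hd : (0 : ℝ) ≤ d := d.2
  have e : ∀ w : ℂ, ((d : ℂ) * w).re = (d : ℝ) * w.re := fun w => Complex.re_ofReal_mul _ _
  refine (norm_exp_sub_exp_le (u := d * (φ - 1)) (v := d * z) ?_ ?_).trans ?_
  · rw [e]
    exact mul_nonpos_of_nonneg_of_nonpos hd (by simpa using h1)
  · rw [e]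
    exact mul_nonpos_of_nonneg_of_nonpos hd hz
  · have : (d : ℂ) * (φ - 1) - d * z = (d : ℝ) * (φ - (1 + z)) := by
      ring
    rw [this, norm_mul, Complex.norm_real, Real.norm_eq_abs, abs_of_nonneg hd]
    gcongr
    exact le_add_of_nonneg_right (by positivity)

/-! ### The log-likelihood ratio of `BP(P)` is nearly Gaussian -/

theorem IsTilt.chiSqCap_mem_Icc {Y : Type*} [MeasurableSpace Y] {P : Kernel Bool Y}
    [IsMarkovKernel P] {N : Measure Y} [IsProbabilityMeasure N] {η : Y → ℝ}
    (h : IsTilt P N η) : chiSqCap P ∈ Set.Icc (0 : ℝ) 1 := by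
  rw [h.chiSqCap_eq]
  refine ⟨integral_nonneg fun y => sq_nonneg _, ?_⟩
  calc ∫ y, η y ^ 2 ∂N ≤ ∫ _, (1 : ℝ) ∂N :=
        integral_mono h.integrable_sq (integrable_const _) fun y =>
          (sq_le_one_iff_abs_le_one _).2 (h.abs_le_one y)
    _ = 1 := by simp

theorem half_pow_sub_pow_mem_Icc {x : ℝ} (hx : x ∈ Set.Icc (0 : ℝ) 1) (n : ℕ) :
    1 / 2 * ((1 + x) ^ n - (1 - x) ^ n) ∈ Set.Icc (0 : ℝ) (2 ^ n) := by
  obtain ⟨h0, h1⟩ := hx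
  have e1 : (1 - x) ^ n ≤ (1 + x) ^ n := pow_le_pow_left₀ (by linarith) (by linarith) n
  have e2 : (1 + x) ^ n ≤ 2 ^ n := pow_le_pow_left₀ (by linarith) (by linarith) n
  have e3 : 0 ≤ (1 - x) ^ n := pow_nonneg (by linarith) n
  have e4 : (0 : ℝ) ≤ 2 ^ n := by positivity
  constructor <;> linarith

/-- The constant in the bound for the characteristic function of half the log-likelihood ratio. -/
noncomputable def charFunConst (n : ℕ) (ξ : ℝ) : ℝ :=
  taylorConst ξ * (2 ^ n) ^ 3 + 3 * (‖Complex.I * ξ - (ξ : ℂ) ^ 2 / 2‖ * 2 ^ n) ^ 2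

/-- The law of half the log-likelihood ratio of `BP(P)` given input `+`. -/
noncomputable def llrLaw (r : ℕ) (lam : ℝ) (D : Measure ℕ) {Y : Type*} [MeasurableSpace Y]
    (P : Kernel Bool Y) (η : Y → ℝ) : Measure ℝ :=
  (bp r lam D P true).map (halfLLR fun b => starDensity (childDensity (r - 1) lam η b))

section Law

variable {Y : Type*} [MeasurableSpace Y] {P : Kernel Bool Y} {N : Measure Y} {η : Y → ℝ}

theorem IsTilt.childDensity_pos (h : IsTilt P N η) {n : ℕ} {lam : ℝ} (hlam : 0 ≤ lam)
    (hsmall : lam * 2 ^ n ≤ 1 / 2) (b : Bool) (y : Fin n → Y) :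
    0 < childDensity n lam η b y := by
  linarith [(abs_le.1 ((h.abs_childDensity_sub_one_le hlam b y).trans hsmall)).1]

theorem IsTilt.measurable_halfLLR_star (h : IsTilt P N η) (n : ℕ) (lam : ℝ) :
    Measurable (halfLLR fun b => starDensity (childDensity n lam η b : (Fin n → Y) → ℝ)) :=
  measurable_halfLLR fun b => measurable_starDensity (h.measurable_childDensity n lam b)

variable [IsMarkovKernel P]

theorem IsTilt.isProbabilityMeasure_llrLaw (h : IsTilt P N η) (r : ℕ) {lam : ℝ}
    (hlam : lam ∈ Set.Icc (0 : ℝ) 1) (D : Measure ℕ) [IsProbabilityMeasure D] :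
    IsProbabilityMeasure (llrLaw r lam D P η) := by
  have := isMarkovKernel_bp r hlam D P
  exact Measure.isProbabilityMeasure_map (h.measurable_halfLLR_star _ _).aemeasurable

variable [IsProbabilityMeasure N]

/-- For small `lam` every child likelihood is strictly positive, so the logarithms are genuine and
the `tanh` formula applies to `BP(P)`. -/
theorem IsTilt.chiSqCap_bp_eq (h : IsTilt P N η) (r : ℕ) {lam : ℝ}
    (hlam : lam ∈ Set.Icc (0 : ℝ) 1) (hsmall : lam * 2 ^ (r - 1) ≤ 1 / 2) (D : Measure ℕ)
    [IsProbabilityMeasure D] :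
    chiSqCap (bp r lam D P) = ∫ x, Real.tanh x ∂(llrLaw r lam D P η) := by
  have := isMarkovKernel_bp r hlam D P
  have := isMarkovKernel_broadcast r hlam
  have hpos := h.childDensity_pos hlam.1 hsmall
  have hm := h.measurable_childDensity (r - 1) lam
  rw [llrLaw, integral_map (h.measurable_halfLLR_star _ _).aemeasurable
    continuous_tanh.aestronglyMeasurable]
  set W := tensorPow P (r - 1) ∘ₖ broadcast r lam
  have hbp : bp r lam D P = mixture D (starPow W) := rfl
  set Q : Measure (Fin (r - 1) → Y) := Measure.pi fun _ => N
  have hW : ∀ b, W b = Q.withDensity fun y =>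
      ENNReal.ofReal (childDensity (r - 1) lam η b y) :=
    fun b => comp_broadcast_eq_withDensity h r hlam b
  rw [chiSqCap_eq_integral_tanh (bp r lam D P)
    (mixture D (starPow (Kernel.const Bool Q)) true)
    (F := fun b => starDensity (childDensity (r - 1) lam η b))
    (fun b => measurable_starDensity (hm b)) (fun b z => Finset.prod_pos fun j _ => hpos b _)
    (fun b => ?_)]
  · rfl
  · rw [hbp]
    exact mixture_starPow_eq_withDensity _ Q hm hpos hW D b

open Complex in
/-- An offspring law whose generating function is close to `exp (d (φ - 1))` on the unit disc gives
a nearly Gaussian log-likelihood ratio. -/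
theorem IsTilt.norm_charFun_llrLaw_sub_le (h : IsTilt P N η) (r : ℕ) {d lam : ℝ} (hd : 0 < d)
    (hlam : lam ∈ Set.Icc (0 : ℝ) 1) (hdl : d * lam ^ 2 ≤ 1)
    (hsmall : lam * 2 ^ (r - 1) ≤ 1 / 2) (D : Measure ℕ) [IsProbabilityMeasure D]
    (hD : ∀ φ z : ℂ, ‖φ‖ ≤ 1 → z.re ≤ 0 →
      ‖∫ t, φ ^ t ∂D - cexp (d * z)‖ ≤ d * (‖φ - (1 + z)‖ + 3 * ‖z‖ ^ 2)) (ξ : ℝ) :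
    ‖charFun (llrLaw r lam D P η) ξ
        - cexp ((I * ξ - ξ ^ 2 / 2) * (s r d lam (chiSqCap P) : ℝ))‖
      ≤ charFunConst (r - 1) ξ / √d := by
  have := isMarkovKernel_broadcast r hlam
  have hpos := h.childDensity_pos hlam.1 hsmall
  have hm := h.measurable_childDensity (r - 1) lam
  obtain ⟨hτ0, hτ1⟩ := half_pow_sub_pow_mem_Icc h.chiSqCap_mem_Icc (r - 1)
  have hexp := h.norm_charFun_child_sub_le r hlam hsmall ξ
  rw [llrLaw]
  unfold bp
  rw [charFun_halfLLR_mixture _ hm hpos D ξ]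
  set φ := ∫ y, cexp (I * (ξ * halfLLR (childDensity (r - 1) lam η) y : ℝ))
          ∂((tensorPow P (r - 1) ∘ₖ broadcast r lam) true) with hφ
  have hφ1 : ‖φ‖ ≤ 1 := norm_integral_exp_I_mul_le _ _
  set n := r - 1
  set τ := 1 / 2 * ((1 + chiSqCap P) ^ n - (1 - chiSqCap P) ^ n) with hτ
  set c : ℂ := I * ξ - (ξ : ℂ) ^ 2 / 2 with hc
  set z : ℂ := c * (lam ^ 2 * τ : ℝ) with hz
  have hcre : c.re ≤ 0 := by
    have : c = ((-(ξ ^ 2 / 2) : ℝ) : ℂ) + (ξ : ℝ) * I := by rw [hc]; push_cast; ring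
    rw [this, Complex.add_re, Complex.ofReal_re, Complex.re_ofReal_mul, Complex.I_re]
    nlinarith [sq_nonneg ξ]
  have hzre : z.re ≤ 0 := by
    rw [hz, Complex.re_mul_ofReal]
    exact mul_nonpos_of_nonpos_of_nonneg hcre (by positivity)
  have hs : c * (s r d lam (chiSqCap P) : ℝ) = d * z := by
    rw [hz, hτ, s]; push_cast; ring
  rw [hs]
  refine (hD φ z hφ1 hzre).trans ?_
  obtain ⟨hl0, hl1⟩ := hlam
  -- The true order is `lam ^ 4`; it is weakened to match the Taylor remainder.
  have hzn : ‖z‖ ^ 2 ≤ lam ^ 3 * (‖c‖ * 2 ^ n) ^ 2 := by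
    rw [hz, norm_mul, Complex.norm_real, Real.norm_eq_abs, abs_of_nonneg (by positivity)]
    calc (‖c‖ * (lam ^ 2 * τ)) ^ 2 = lam ^ 4 * (‖c‖ * τ) ^ 2 := by ring
      _ ≤ lam ^ 3 * (‖c‖ * 2 ^ n) ^ 2 := by
          gcongr ?_ * (_ * ?_) ^ 2
          exact pow_le_pow_of_le_one hl0 hl1 (by norm_num)
  have hsq : √d * lam ≤ 1 := by
    rw [← Real.sqrt_sq hl0, ← Real.sqrt_mul hd.le]
    exact Real.sqrt_le_one.2 hdl
  -- Summing about `d` errors of order `lam ^ 3` costs `(d * lam ^ 2) * lam ≤ lam ≤ 1 / √d`.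
  have hd3 : d * lam ^ 3 ≤ 1 / √d := by
    rw [le_div_iff₀ (Real.sqrt_pos.2 hd)]
    calc d * lam ^ 3 * √d = (d * lam ^ 2) * (√d * lam) := by ring
      _ ≤ 1 * 1 := by gcongr
      _ = 1 := one_mul 1
  have hC : 0 ≤ charFunConst n ξ := by
    have := taylorConst_nonneg ξ
    unfold charFunConst
    positivity
  calc d * (‖φ - (1 + z)‖ + 3 * ‖z‖ ^ 2)
      ≤ d * (taylorConst ξ * (lam * 2 ^ n) ^ 3 + 3 * (lam ^ 3 * (‖c‖ * 2 ^ n) ^ 2)) := by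
        gcongr
    _ = (d * lam ^ 3) * charFunConst n ξ := by
        rw [charFunConst, ← hc]; ring
    _ ≤ 1 / √d * charFunConst n ξ := by gcongr
    _ = charFunConst n ξ / √d := by ring

end Law

end BOHT

/-! ### Choice of the threshold and conclusion -/

theorem mainTheorem9 (r : ℕ) (hr : 2 ≤ r) (ε : ℝ) (hε : 0 < ε) :
    ∃ d₀ : ℝ, 0 < d₀ ∧
      ∀ (d : ℝ≥0) (lam : ℝ), d₀ ≤ (d : ℝ) → lam ∈ Set.Icc (0 : ℝ) 1 →
        ((r : ℝ) - 1) * (d : ℝ) * lam ^ 2 ≤ 1 →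
        ∀ (Y : Type*) [MeasurableSpace Y] (P : Kernel Bool Y) [IsMarkovKernel P],
          BOHT.IsBMS P →
          -- regular hypertrees: `d` is an integer and the offspring number is exactly `d`
          (∀ n : ℕ, (n : ℝ≥0) = d →
            |BOHT.chiSqCap (BOHT.bp r lam (Measure.dirac n) P)
              - BOHT.g r d lam (BOHT.chiSqCap P)| ≤ ε) ∧
          -- Poisson hypertrees: the offspring number has law `Pois(d)`
          |BOHT.chiSqCap (BOHT.bp r lam (poissonMeasure d) P)
            - BOHT.g r d lam (BOHT.chiSqCap P)| ≤ ε := by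
  obtain ⟨d₁, hd₁, hmain⟩ :=
    BOHT.exists_abs_integral_tanh_sub_le (2 ^ (r - 1)) (BOHT.charFunConst (r - 1)) hε
  -- The second bound turns `d * lam ^ 2 ≤ 1` into `lam * 2 ^ (r - 1) ≤ 1 / 2`, the smallness needed
  -- for the expansion.
  refine ⟨max d₁ ((2 ^ (r - 1) * 2) ^ 2), lt_max_of_lt_left hd₁, ?_⟩
  intro d lam hd hlam hrd Y _ P _ _
  obtain ⟨N, η, _, h⟩ := BOHT.exists_isTilt P
  have hd1 : d₁ ≤ (d : ℝ) := (le_max_left _ _).trans hd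
  have hd0 : (0 : ℝ) < d := hd₁.trans_le hd1
  have hr2 : (2 : ℝ) ≤ r := by exact_mod_cast hr
  have hdl0 : 0 ≤ (d : ℝ) * lam ^ 2 := by positivity
  -- Here `r ≥ 2` enters, through `r - 1 ≥ 1`.
  have hdl : (d : ℝ) * lam ^ 2 ≤ 1 := by nlinarith
  have hsmall : lam * 2 ^ (r - 1) ≤ 1 / 2 := by
    have h1 : (lam * (2 ^ (r - 1) * 2)) ^ 2 ≤ 1 := by
      calc (lam * (2 ^ (r - 1) * 2)) ^ 2 = (2 ^ (r - 1) * 2) ^ 2 * lam ^ 2 := by ring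
        _ ≤ d * lam ^ 2 := by
            gcongr
            exact (le_max_right _ _).trans hd
        _ ≤ 1 := hdl
    linarith [(abs_le.1 ((sq_le_one_iff_abs_le_one _).1 h1)).2]
  obtain ⟨hτ0, hτ1⟩ := BOHT.half_pow_sub_pow_mem_Icc h.chiSqCap_mem_Icc (r - 1)
  have hs : BOHT.s r d lam (BOHT.chiSqCap P) = d * lam ^ 2 * (1 / 2 *
      ((1 + BOHT.chiSqCap P) ^ (r - 1) - (1 - BOHT.chiSqCap P) ^ (r - 1))) := by
    rw [BOHT.s]; ring
  have hsmem : BOHT.s r d lam (BOHT.chiSqCap P) ∈ Set.Icc (0 : ℝ) (2 ^ (r - 1)) := by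
    rw [hs]
    exact ⟨mul_nonneg hdl0 hτ0, (mul_le_of_le_one_left hτ0 hdl).trans hτ1⟩
  have key : ∀ D : Measure ℕ, IsProbabilityMeasure D →
      (∀ φ z : ℂ, ‖φ‖ ≤ 1 → z.re ≤ 0 → ‖∫ t, φ ^ t ∂D - Complex.exp ((d : ℝ) * z)‖
        ≤ (d : ℝ) * (‖φ - (1 + z)‖ + 3 * ‖z‖ ^ 2)) →
      |BOHT.chiSqCap (BOHT.bp r lam D P) - BOHT.g r d lam (BOHT.chiSqCap P)| ≤ ε := by
    intro D _ hD
    rw [h.chiSqCap_bp_eq r hlam hsmall D, BOHT.g_eq_integral_gaussianReal _ _ _ _ hsmem.1]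
    exact hmain d hd1 _ hsmem _ (h.isProbabilityMeasure_llrLaw r hlam D)
      (h.norm_charFun_llrLaw_sub_le r hd0 hlam hdl hsmall D hD)
  refine ⟨fun n hn => key _ inferInstance fun φ z hφ hz => ?_,
    key _ inferInstance fun φ z hφ hz => ?_⟩
  · rw [integral_dirac, ← hn]
    simpa using BOHT.norm_pow_sub_exp_le hφ hz n
  · rw [BOHT.integral_pow_poissonMeasure]
    exact BOHT.norm_exp_mul_sub_one_sub_exp_le hφ hz d
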